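/- Let $d\ge 2$, $1\le l\le d-1$, and read all mode indices cyclically modulo $d$. Let $n_1,\dots,n_d$ and $r_1,\dots,r_d$ be positive integers with $r_kr_{k+1}\le n_k$ for all $k$ (the critical or subcritical case). Let $\mathcal T\in\mathbb R^{n_1\times\dots\times n_d}$ have a tensor ring (TR) decomposition with ranks $[r_1,\dots,r_d]$, $$t_{j_1\cdots j_d}=\operatorname{tr}\bigl(\boldsymbol\Sigma^{(1)}\mathbf G^{(1)}_{j_1}\cdots\boldsymbol\Sigma^{(d)}\mathbf G^{(d)}_{j_d}\bigr),$$ where the cores $\mathcal G^{(k)}\in\mathbb R^{r_k\times n_k\times r_{k+1}}$ have mode-2 slices $\mathbf G^{(k)}_{j}$ and mode-2 fibers of Euclidean norm $1$, and the $\boldsymbol\Sigma^{(k)}\in\mathbb R^{r_k\times r_k}$ are diagonal with positive diagonal. Assume the strong TR incoherence condition with some parameters $\mu_1,\dots,\mu_d>0$: for all $k$ and all $j,j'$, $$\Bigl|\langle \mathbf G^{(k)}_{j},\mathbf G^{(k)}_{j'}\rangle-\tfrac{r_kr_{k+1}}{n_k}1_{j=j'}\Bigr|\le\frac{\mu_k\sqrt{r_kr_{k+1}}}{n_k}.$$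 For a tensor $\mathcal X$ let $\mathbf X_{\{i,l\}}$ be its $i$-shifting $l$-matricization: the matrix whose rows are indexed by $(j_i,\dots,j_{i+l-1})$ and whose columns are indexed by $(j_{i+l},\dots,j_{i-1})$. It has $a_{il}=\prod_{k=i}^{i+l-1}n_k$ rows and $b_{il}=\prod_{k=i+l}^{i-1}n_k$ columns; put $\overline n_{il}=\max\{a_{il},b_{il}\}$ and $\rho_{il}=r_ir_{i+l}$. Let $\mathbf T_{\{i,l\}}=\mathbf U\mathbf S\mathbf V^{\mathsf T}$ be a compact singular value decomposition (orthonormal columns, positive singular values), and let $\mu_{il}$ be the strong incoherence parameter of the singular vectors of $\mathbf T_{\{i,l\}}$, that is, the maximum $\mu_{il}=\max\{\mu'_{1il},\mu'_{2il},\mu''_{il}\}$ of the least constants such that for all $p,p',q,q'$ $$\Bigl|(\mathbf U\mathbf U^{\mathsf T})_{pp'}-\tfrac{\rho_{il}}{a_{il}}1_{p=p'}\Bigr|\le\frac{\mu'_{1il}\sqrt{\rho_{il}}}{a_{il}},\qquad \Bigl|(\mathbf V\mathbf V^{\mathsf T})_{qq'}-\tfrac{\rho_{il}}{b_{il}}1_{q=q'}\Bigr|\le\frac{\mu'_{2il}\sqrt{\rho_{il}}}{b_{il}},\qquad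 \bigl|(\mathbf U\mathbf V^{\mathsf T})_{pq}\bigr|\le\frac{\mu''_{il}\sqrt{\rho_{il}}}{\sqrt{a_{il}b_{il}}}$$ (these do not depend on the choice of the decomposition). Let $w_1,\dots,w_{\lceil d/2\rceil}\ge0$ be weights, not all zero, let $0\le m\le\prod_kn_k$, and let $\Omega$ be uniformly distributed over all sets of $m$ index tuples. Consider $$\min_{\mathcal X}\ \sum_{i=1}^{\lceil d/2\rceil}w_i\|\mathbf X_{\{i,l\}}\|_*\quad\text{subject to}\quad x_{j}=t_{j}\ \text{ for all } j\in\Omega ,\tag{P}$$ where $\|\cdot\|_*$ is the nuclear norm. (1) There is a numerical constant $C>0$, independent of all of the above data, such that if $$m\ \ge\ C\max_{1\le i\le\lceil d/2\rceil}\mu_{il}^2\,\overline n_{il}\,r_ir_{i+l}\ln^6(\overline n_{il}),$$ then $\mathcal T$ is the unique solution of (P) with probability at least $1-\max_{1\le i\le\lceil d/2\rceil}\overline n_{il}^{-3}$. (2) In particular, for every $K>0$ there is a constant $C_K>0$, depending only on $K$, such that if $n_1=\dots=n_d=n$, $r_1=\dots=r_d=r$, $l=\lceil d/2\rceil$ and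 $\mu_{il}\le K\sqrt{\ln(n^{\lceil d/2\rceil})}$ for $1\le i\le\lceil d/2\rceil$, then $$m\ \ge\ C_K\,n^{\lceil d/2\rceil}r^2\ln^7\bigl(n^{\lceil d/2\rceil}\bigr)$$ implies that $\mathcal T$ is the unique solution of (P) with probability at least $1-n^{-3\lceil d/2\rceil}$. -/

import Mathlib

open scoped Matrix

noncomputable section

/-- Real tensors of order `d` and size `n 0 × ⋯ × n (d-1)`. Modes are elements of `Fin d`, so that
`k + 1` and `i + l` are taken cyclically. -/
abbrev RTensor {d : ℕ} (n : Fin d → ℕ) : Type := (∀ k, Fin (n k)) → ℝ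

/-- Tensor ring factors: cores `G k` of size `r k × n k × r (k+1)` whose mode-2 fibers are
normalized, together with the diagonals `σ k` of the (positive) singular value matrices. -/
structure TensorRing {d : ℕ} [NeZero d] (n r : Fin d → ℕ) where
  G : ∀ k : Fin d, Fin (r k) → Fin (n k) → Fin (r (k + 1)) → ℝ
  σ : ∀ k : Fin d, Fin (r k) → ℝ
  fiber_norm : ∀ k s t, ∑ j, G k s j t ^ 2 = 1
  σ_pos : ∀ k s, 0 < σ k s

namespace TensorRing

variable {d : ℕ} [NeZero d] {n r : Fin d → ℕ}

/-- The represented tensor: the entry at `j` is `tr (Σ⁽¹⁾ G⁽¹⁾_{j₁} ⋯ Σ⁽ᵈ⁾ G⁽ᵈ⁾_{j_d})`, written out as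
a sum over all bond indices. -/
def eval (R : TensorRing n r) : RTensor n := fun j =>
  ∑ t : (∀ k, Fin (r k)), ∏ k, R.σ k (t k) * R.G k (t k) (j k) (t (k + 1))

/-- The strong incoherence property of the cores, with parameters `μ`. -/
def StrongIncoherent (R : TensorRing n r) (μ : Fin d → ℝ) : Prop :=
  (∀ k, 0 < μ k) ∧ ∀ (k : Fin d) (j j' : Fin (n k)),
    |(∑ s, ∑ t, R.G k s j t * R.G k s j' t)
        - (if j = j' then (r k * r (k + 1) : ℝ) / n k else 0)|
      ≤ μ k * √(r k * r (k + 1) : ℝ) / n k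

end TensorRing

/-- The ring is subcritical or critical. -/
def SubOrCritical {d : ℕ} [NeZero d] (n r : Fin d → ℕ) : Prop :=
  ∀ k, r k * r (k + 1) ≤ n k

section Unfolding

variable {d : ℕ}

/-- `k` is one of the `l` cyclically consecutive modes `i, i+1, …, i+l-1`. -/
def InArc (i : Fin d) (l : ℕ) (k : Fin d) : Prop := (k - i).val < l

instance (i : Fin d) (l : ℕ) : DecidablePred (InArc i l) :=
  fun k => inferInstanceAs (Decidable ((k - i).val < l))

/-- Row multi-indices `(j_i, …, j_{i+l-1})` of the `i`-shifting `l`-matricization. -/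
abbrev RowIdx (n : Fin d → ℕ) (i : Fin d) (l : ℕ) : Type :=
  ∀ k : {k : Fin d // InArc i l k}, Fin (n k)

/-- Column multi-indices `(j_{i+l}, …, j_{i-1})` of the `i`-shifting `l`-matricization. -/
abbrev ColIdx (n : Fin d → ℕ) (i : Fin d) (l : ℕ) : Type :=
  ∀ k : {k : Fin d // ¬ InArc i l k}, Fin (n k)

/-- The `i`-shifting `l`-matricization of a tensor, with rows and columns labelled by multi-indices
(instead of by their positions in a linear enumeration of the multi-indices). -/
def unfold {n : Fin d → ℕ} (X : RTensor n) (i : Fin d) (l : ℕ) :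
    Matrix (RowIdx n i l) (ColIdx n i l) ℝ :=
  Matrix.of fun a b => X fun k => if h : InArc i l k then a ⟨k, h⟩ else b ⟨k, h⟩

/-- The larger one of the two dimensions of the `i`-shifting `l`-matricization. -/
def nbar (n : Fin d → ℕ) (i : Fin d) (l : ℕ) : ℕ :=
  max (∏ k with InArc i l k, n k) (∏ k with ¬ InArc i l k, n k)

end Unfolding

/-- The nuclear norm: the sum of the singular values. -/
def nuclearNorm {α β : Type} [Fintype α] [DecidableEq α] [Fintype β] [DecidableEq β]
    (M : Matrix α β ℝ) : ℝ :=
  (Matrix.toEuclideanLin M).singularValues.sum fun _ s => s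

/-- A compact singular value decomposition `M = U diag(s) Vᵀ`: `U` and `V` have orthonormal columns,
and all of the listed singular values are positive. -/
structure CompactSVD {α β : Type} [Fintype α] [Fintype β] (M : Matrix α β ℝ) where
  rk : ℕ
  U : Matrix α (Fin rk) ℝ
  s : Fin rk → ℝ
  V : Matrix β (Fin rk) ℝ
  s_pos : ∀ k, 0 < s k
  U_orth : Uᵀ * U = 1
  V_orth : Vᵀ * V = 1
  eq : M = U * Matrix.diagonal s * Vᵀ

namespace CompactSVD

variable {α β : Type} [Fintype α] [DecidableEq α] [Fintype β] [DecidableEq β] {M : Matrix α β ℝ}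

/-- The least `μ` with `|⟨U_a, U_a'⟩ - (ρ / |α|) 1_{a = a'}| ≤ μ √ρ / |α|` for all rows `a`, `a'`. -/
def leftParam (S : CompactSVD M) (ρ : ℝ) : ℝ :=
  ⨆ p : α × α, |(S.U * S.Uᵀ) p.1 p.2 - (if p.1 = p.2 then ρ / Fintype.card α else 0)|
    * Fintype.card α / √ρ

/-- The least `μ` with `|⟨V_b, V_b'⟩ - (ρ / |β|) 1_{b = b'}| ≤ μ √ρ / |β|` for all rows `b`, `b'`. -/
def rightParam (S : CompactSVD M) (ρ : ℝ) : ℝ :=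
  ⨆ p : β × β, |(S.V * S.Vᵀ) p.1 p.2 - (if p.1 = p.2 then ρ / Fintype.card β else 0)|
    * Fintype.card β / √ρ

/-- The least `μ` with `|⟨U_a, V_b⟩| ≤ μ √ρ / √(|α| |β|)` for all rows `a` of `U` and `b` of `V`. -/
def crossParam (S : CompactSVD M) (ρ : ℝ) : ℝ :=
  ⨆ p : α × β, |(S.U * S.Vᵀ) p.1 p.2| * √(Fintype.card α * Fintype.card β : ℝ) / √ρ

/-- The strong incoherence parameter of the singular vectors: the largest of the three. -/
def incoherence (S : CompactSVD M) (ρ : ℝ) : ℝ :=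
  max (max (S.leftParam ρ) (S.rightParam ρ)) (S.crossParam ρ)

end CompactSVD

/-- The first `⌈d/2⌉` modes, over which the nuclear norms are summed. -/
def shifts (d : ℕ) : Finset (Fin d) := {i | i.val < (d + 1) / 2}

theorem shifts_nonempty (d : ℕ) [NeZero d] : (shifts d).Nonempty := by
  have hd : d ≠ 0 := NeZero.ne d
  refine ⟨⟨0, by omega⟩, ?_⟩
  simp only [shifts, Finset.mem_filter, Finset.mem_univ, true_and]
  omega

section Completion

variable {d : ℕ} {n : Fin d → ℕ}

/-- The objective `∑ᵢ wᵢ ‖X_{i,l}‖_*`. -/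
def objective (w : Fin d → ℝ) (l : ℕ) (X : RTensor n) : ℝ :=
  ∑ i ∈ shifts d, w i * nuclearNorm (unfold X i l)

/-- `T` is the unique minimizer of the objective among the tensors that agree with `T` on `Ω`. -/
def IsUniqueSolution (w : Fin d → ℝ) (l : ℕ) (T : RTensor n) (Ω : Finset (∀ k, Fin (n k))) : Prop :=
  ∀ X : RTensor n, (∀ j ∈ Ω, X j = T j) → X ≠ T → objective w l T < objective w l X

open Classical in
/-- The probability that `T` is the unique solution when `Ω` is uniformly distributed over all sets
of `m` index tuples. -/
def recoveryProb (w : Fin d → ℝ) (l m : ℕ) (T : RTensor n) : ℝ :=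
  (((Finset.univ : Finset (∀ k, Fin (n k))).powersetCard m).filter
      (IsUniqueSolution w l T)).card
    / ((Finset.univ : Finset (∀ k, Fin (n k))).powersetCard m).card

/-- The failure bound `max_i n̄_{il}⁻³`. -/
def failureBound [NeZero d] (n : Fin d → ℕ) (l : ℕ) : ℝ :=
  (shifts d).sup' (shifts_nonempty d) fun i => ((nbar n i l : ℝ) ^ 3)⁻¹

end Completion

end

/-!
Since unfolding `i` has at least `√(∏ n)` rows or columns, it suffices to show that each unfolding
`M` alone is recovered by nuclear norm minimization up to probability `n̄⁻⁵`, and to take a union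
bound. The number of unfoldings is not bounded by a power of `n̄`, but modes of size one are
irrelevant, and the remaining ones admit at most `∏ n ≤ n̄²` different sets of rows.

For a matrix `M = U S Vᵀ` the argument is golfing (Gross, Recht). Sampling without replacement is
at least as good as sampling with replacement, so the observed entries may be split into independent
batches. By the matrix Bernstein inequality (Ahlswede–Winter method, from Golden–Thompson), with
high probability each batch approximates the identity on the tangent space at `M`. Correcting a
matrix supported on the sampled entries with one batch halves the distance of its tangential part
from `U Vᵀ`, while its part orthogonal to the tangent space stays of norm less than one. After
logarithmically many batches this matrix is an approximate dual certificate.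
-/

/-! ### The Golden–Thompson inequality for real symmetric matrices -/

section LieProductFormula

open Filter Topology NormedSpace

variable {R : Type*} [NormedRing R]

section NormOneClass

variable [NormOneClass R]

theorem norm_pow_succ_sub_pow_succ_le {x y : R} {c : ℝ} (hx : ‖x‖ ≤ c) (hy : ‖y‖ ≤ c) (n : ℕ) :
    ‖x ^ (n + 1) - y ^ (n + 1)‖ ≤ (n + 1) * c ^ n * ‖x - y‖ := by
  have hc : 0 ≤ c := (norm_nonneg x).trans hx
  induction n with
  | zero => simp
  | succ n ih =>
    have hyn : ‖y ^ (n + 1)‖ ≤ c ^ (n + 1) :=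
      (norm_pow_le _ _).trans (pow_le_pow_left₀ (norm_nonneg _) hy _)
    calc ‖x ^ (n + 1 + 1) - y ^ (n + 1 + 1)‖
        = ‖x * (x ^ (n + 1) - y ^ (n + 1)) + (x - y) * y ^ (n + 1)‖ := by
          rw [pow_succ' x, pow_succ' y (n + 1)]
          noncomm_ring
      _ ≤ ‖x‖ * ‖x ^ (n + 1) - y ^ (n + 1)‖ + ‖x - y‖ * ‖y ^ (n + 1)‖ :=
          (norm_add_le _ _).trans (add_le_add (norm_mul_le _ _) (norm_mul_le _ _))
      _ ≤ c * ((n + 1) * c ^ n * ‖x - y‖) + ‖x - y‖ * c ^ (n + 1) := by gcongr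
      _ = ((n + 1 : ℕ) + 1) * c ^ (n + 1) * ‖x - y‖ := by push_cast; ring

variable [NormedAlgebra ℝ R]

theorem norm_exp_le_exp_norm (x : R) : ‖exp x‖ ≤ Real.exp ‖x‖ := by
  have hs : Summable fun n : ℕ => (n.factorial : ℝ)⁻¹ * ‖x‖ ^ n := by
    simpa only [smul_eq_mul] using expSeries_summable' (𝕂 := ℝ) (‖x‖ : ℝ)
  have hexp : Real.exp ‖x‖ = ∑' n : ℕ, (n.factorial : ℝ)⁻¹ * ‖x‖ ^ n := by
    simp only [Real.exp_eq_exp_ℝ, exp_eq_tsum ℝ, smul_eq_mul]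
  rw [hexp, exp_eq_tsum ℝ]
  refine tsum_of_norm_bounded hs.hasSum fun n => ?_
  rw [norm_smul, Real.norm_of_nonneg (by positivity)]
  gcongr
  exact norm_pow_le _ _

theorem norm_exp_mul_exp_le (A B : R) : ‖exp A * exp B‖ ≤ Real.exp (‖A‖ + ‖B‖) := by
  rw [Real.exp_add]
  exact (norm_mul_le _ _).trans (mul_le_mul (norm_exp_le_exp_norm A) (norm_exp_le_exp_norm B)
    (norm_nonneg _) (Real.exp_nonneg _))

end NormOneClass

variable [NormedAlgebra ℝ R] [CompleteSpace R]

theorem exp_inv_smul_pow (A : R) {n : ℕ} (hn : n ≠ 0) : exp ((n : ℝ)⁻¹ • A) ^ n = exp A := by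
  let _ : NormedAlgebra ℚ R := NormedAlgebra.restrictScalars ℚ ℝ R
  rw [← exp_nsmul, ← Nat.cast_smul_eq_nsmul ℝ, smul_inv_smul₀ (Nat.cast_ne_zero.2 hn)]

theorem tendsto_mul_norm_exp_smul_add_sub (A B : R) :
    Tendsto (fun n : ℕ => (n : ℝ) *
      ‖exp ((n : ℝ)⁻¹ • (A + B)) - exp ((n : ℝ)⁻¹ • A) * exp ((n : ℝ)⁻¹ • B)‖) atTop (𝓝 0) := by
  have hlim : Tendsto (fun n : ℕ => (n : ℝ)⁻¹) atTop (𝓝[≠] 0) :=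
    tendsto_nhdsWithin_iff.2 ⟨tendsto_inv_atTop_nhds_zero_nat,
      (eventually_ne_atTop 0).mono fun n hn => inv_ne_zero (Nat.cast_ne_zero.2 hn)⟩
  have hder : HasDerivAt (fun t : ℝ => exp (t • (A + B)) - exp (t • A) * exp (t • B)) 0 0 := by
    simpa [exp_zero, Pi.sub_def, Pi.mul_def] using
      (hasDerivAt_exp_smul_const (𝕂 := ℝ) (A + B) 0).sub
        ((hasDerivAt_exp_smul_const (𝕂 := ℝ) A 0).mul (hasDerivAt_exp_smul_const (𝕂 := ℝ) B 0))
  have hslope := ((hasDerivAt_iff_tendsto_slope.1 hder).comp hlim).norm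
  rw [norm_zero] at hslope
  refine hslope.congr fun n => ?_
  simp only [Function.comp_apply, slope, vsub_eq_sub, sub_zero, zero_smul, exp_zero, mul_one,
    sub_self, norm_smul, inv_inv, RCLike.norm_natCast]

/-- The Lie product formula. -/
theorem tendsto_exp_smul_mul_exp_smul_pow [NormOneClass R] (A B : R) :
    Tendsto (fun n : ℕ => (exp ((n : ℝ)⁻¹ • A) * exp ((n : ℝ)⁻¹ • B)) ^ n)
      atTop (𝓝 (exp (A + B))) := by
  set c := ‖A‖ + ‖B‖
  have hbound := (tendsto_mul_norm_exp_smul_add_sub A B).const_mul (Real.exp c)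
  rw [mul_zero] at hbound
  rw [tendsto_iff_norm_sub_tendsto_zero]
  refine squeeze_zero' (Eventually.of_forall fun _ => norm_nonneg _) ?_ hbound
  filter_upwards [eventually_ne_atTop 0] with n hn
  have hnorm : ∀ X : R, ‖(n : ℝ)⁻¹ • X‖ = (n : ℝ)⁻¹ * ‖X‖ := fun X => by
    rw [norm_smul, norm_inv, RCLike.norm_natCast]
  have hleft : ‖exp ((n : ℝ)⁻¹ • A) * exp ((n : ℝ)⁻¹ • B)‖ ≤ Real.exp ((n : ℝ)⁻¹ * c) := by
    simpa only [hnorm, ← mul_add] using norm_exp_mul_exp_le ((n : ℝ)⁻¹ • A) ((n : ℝ)⁻¹ • B)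
  have hright : ‖exp ((n : ℝ)⁻¹ • (A + B))‖ ≤ Real.exp ((n : ℝ)⁻¹ * c) := by
    refine (norm_exp_le_exp_norm _).trans (Real.exp_le_exp.2 ?_)
    rw [hnorm]
    gcongr
    exact norm_add_le _ _
  have hpow : Real.exp ((n : ℝ)⁻¹ * c) ^ (n - 1) ≤ Real.exp c := by
    calc Real.exp ((n : ℝ)⁻¹ * c) ^ (n - 1) ≤ Real.exp ((n : ℝ)⁻¹ * c) ^ n :=
          pow_le_pow_right₀ (Real.one_le_exp (by positivity)) (Nat.sub_le n 1)
      _ = Real.exp c := by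
          rw [← Real.exp_nat_mul, mul_inv_cancel_left₀ (Nat.cast_ne_zero.2 hn)]
  obtain ⟨k, rfl⟩ := Nat.exists_eq_succ_of_ne_zero hn
  rw [← exp_inv_smul_pow (A + B) hn, norm_sub_rev]
  calc _ ≤ (k + 1) * Real.exp (((k + 1 : ℕ) : ℝ)⁻¹ * c) ^ k * _ :=
        norm_pow_succ_sub_pow_succ_le hright hleft k
    _ ≤ (k + 1) * Real.exp c * _ := by gcongr; exact hpow
    _ = _ := by push_cast; ring

end LieProductFormula

section GoldenThompson

open Filter Topology NormedSpace
open scoped Matrix.Norms.L2Operator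

variable {D : Type*} [Fintype D]

theorem trace_transpose_mul_self_eq_sum_sq {A B : Type*} [Fintype A] [Fintype B]
    (X : Matrix A B ℝ) : (Xᵀ * X).trace = ∑ i, ∑ j, X i j ^ 2 := by
  rw [Finset.sum_comm]
  simp [Matrix.trace, Matrix.mul_apply, sq]

theorem abs_trace_mul_le {X Y : Matrix D D ℝ} {c : ℝ} (hX : (Xᵀ * X).trace ≤ c)
    (hY : (Yᵀ * Y).trace ≤ c) : |(X * Y).trace| ≤ c := by
  rw [trace_transpose_mul_self_eq_sum_sq] at hX hY
  rw [Finset.sum_comm] at hY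
  calc |(X * Y).trace| ≤ ∑ i, ∑ j, |X i j * Y j i| := by
        simp only [Matrix.trace, Matrix.diag, Matrix.mul_apply]
        exact (Finset.abs_sum_le_sum_abs _ _).trans
          (Finset.sum_le_sum fun _ _ => Finset.abs_sum_le_sum_abs _ _)
    _ ≤ ∑ i, ∑ j, (X i j ^ 2 / 2 + Y j i ^ 2 / 2) :=
        Finset.sum_le_sum fun i _ => Finset.sum_le_sum fun j _ =>
          abs_le.2 ⟨by nlinarith [sq_nonneg (X i j + Y j i)],
            by nlinarith [sq_nonneg (X i j - Y j i)]⟩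
    _ ≤ c := by
        simp only [Finset.sum_add_distrib, ← Finset.sum_div]
        linarith

/-- The product of the first `2 ^ k` terms of a sequence, bracketed as a binary tree. It carries the
induction on `k` in the Hölder inequality for Schatten norms. -/
def dyadicProd {M : Type*} [Mul M] : ℕ → (ℕ → M) → M
  | 0, A => A 0
  | k + 1, A => dyadicProd k fun i => A (2 * i) * A (2 * i + 1)

theorem dyadicProd_const {M : Type*} [Monoid M] (k : ℕ) (a : M) :
    dyadicProd k (fun _ => a) = a ^ 2 ^ k := by
  induction k generalizing a with
  | zero => simp [dyadicProd]
  | succ k ih => simp only [dyadicProd, ih, pow_succ' 2, pow_mul, sq]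

theorem dyadicProd_alternating {M : Type*} [Monoid M] (k : ℕ) (a b : M) :
    dyadicProd (k + 1) (fun j => if j % 2 = 0 then a else b) = (a * b) ^ 2 ^ k := by
  rw [dyadicProd, ← dyadicProd_const]
  congr 1
  funext i
  rw [if_pos (by omega), if_neg (by omega)]

variable [DecidableEq D]

theorem trace_mul_pow_comm (X Y : Matrix D D ℝ) (n : ℕ) :
    ((X * Y) ^ n).trace = ((Y * X) ^ n).trace := by
  cases n with
  | zero => simp
  | succ n =>
    have h : SemiconjBy X (Y * X) (X * Y) := (mul_assoc X Y X).symm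
    rw [pow_succ, ← mul_assoc, ← (h.pow_right n).eq, mul_assoc, Matrix.trace_mul_comm, mul_assoc,
      ← pow_succ]

/-- A Hölder inequality for Schatten norms of dyadic exponent. -/
theorem abs_trace_dyadicProd_le (k : ℕ) (A : ℕ → Matrix D D ℝ) (c : ℝ)
    (h : ∀ i, (((A i)ᵀ * A i) ^ 2 ^ k).trace ≤ c) : |(dyadicProd (k + 1) A).trace| ≤ c := by
  induction k generalizing A with
  | zero =>
    simp only [pow_zero, pow_one] at h
    exact abs_trace_mul_le (h 0) (h 1)
  | succ k ih =>
    refine ih (fun i => A (2 * i) * A (2 * i + 1)) fun i => ?_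
    have hX := h (2 * i)
    have hY := h (2 * i + 1)
    set X := A (2 * i)
    set Y := A (2 * i + 1)
    have hcyclic : (((X * Y)ᵀ * (X * Y)) ^ 2 ^ k).trace
        = (dyadicProd (k + 1) fun j : ℕ => if j % 2 = 0 then Xᵀ * X else Y * Yᵀ).trace := by
      rw [dyadicProd_alternating, Matrix.transpose_mul, mul_assoc, trace_mul_pow_comm]
      simp only [mul_assoc]
    rw [hcyclic]
    refine (le_abs_self _).trans (ih _ fun j => ?_)
    split_ifs
    · rw [pow_succ' 2, pow_mul, sq] at hX
      simpa only [Matrix.transpose_mul, Matrix.transpose_transpose] using hX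
    · rw [trace_mul_pow_comm, pow_succ' 2, pow_mul, sq] at hY
      simpa only [Matrix.transpose_mul, Matrix.transpose_transpose] using hY

theorem trace_mul_pow_two_pow_le {X Y : Matrix D D ℝ} (hX : X.IsSymm) (hY : Y.IsSymm) (k : ℕ) :
    ((X * Y) ^ 2 ^ k).trace ≤ (X ^ 2 ^ k * Y ^ 2 ^ k).trace := by
  induction k generalizing X Y with
  | zero => simp
  | succ k ih =>
    calc ((X * Y) ^ 2 ^ (k + 1)).trace ≤ (((X * Y)ᵀ * (X * Y)) ^ 2 ^ k).trace := by
          rw [← dyadicProd_const]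
          exact (le_abs_self _).trans (abs_trace_dyadicProd_le k (fun _ => X * Y) _ fun _ => le_rfl)
      _ = ((X ^ 2 * Y ^ 2) ^ 2 ^ k).trace := by
          rw [Matrix.transpose_mul, hX.eq, hY.eq, mul_assoc, trace_mul_pow_comm]
          simp only [sq, mul_assoc]
      _ ≤ (X ^ 2 ^ (k + 1) * Y ^ 2 ^ (k + 1)).trace := by
          simpa only [← pow_mul, ← pow_succ'] using ih (hX.pow 2) (hY.pow 2)

/-- The **Golden–Thompson inequality**. -/
theorem trace_exp_add_le {A B : Matrix D D ℝ} (hA : A.IsSymm) (hB : B.IsSymm) :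
    (exp (A + B)).trace ≤ (exp A * exp B).trace := by
  cases isEmpty_or_nonempty D
  · simp [Matrix.trace]
  have hlim := (continuous_id.matrix_trace.tendsto _).comp
    ((tendsto_exp_smul_mul_exp_smul_pow A B).comp (tendsto_pow_atTop_atTop_of_one_lt one_lt_two))
  refine le_of_tendsto hlim (Eventually.of_forall fun k => ?_)
  have hk : 2 ^ k ≠ 0 := (Nat.two_pow_pos k).ne'
  refine (trace_mul_pow_two_pow_le (hA.smul _).exp (hB.smul _).exp k).trans_eq ?_
  rw [exp_inv_smul_pow A hk, exp_inv_smul_pow B hk]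

end GoldenThompson

/-! ### Frequencies -/

section Frequency

open scoped BigOperators

variable {Ω : Type*} {A : Finset Ω} {p q : Ω → Prop}

open Classical in
/-- The proportion of the elements of `A` with the property `p`, that is, the probability of `p`
under the uniform distribution on `A`. -/
noncomputable def freq (A : Finset Ω) (p : Ω → Prop) : ℝ := (A.filter p).card / A.card

theorem freq_eq [DecidablePred p] : freq A p = (A.filter p).card / A.card := by
  unfold freq
  congr!

theorem freq_eq_expect [DecidablePred p] : freq A p = 𝔼 ω ∈ A, if p ω then (1 : ℝ) else 0 := by
  rw [freq_eq, Finset.expect_eq_sum_div_card, Finset.sum_boole]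

theorem freq_nonneg : 0 ≤ freq A p := by
  unfold freq
  positivity

theorem freq_mono (h : ∀ ω ∈ A, p ω → q ω) : freq A p ≤ freq A q := by
  classical
  unfold freq
  gcongr 1
  exact Nat.cast_le.2 (Finset.card_le_card (Finset.monotone_filter_right A h))

theorem freq_exists_le {κ : Type*} (s : Finset κ) (p : κ → Ω → Prop) :
    freq A (fun ω => ∃ k ∈ s, p k ω) ≤ ∑ k ∈ s, freq A (p k) := by
  classical
  simp only [freq, ← Finset.sum_div]
  gcongr 1
  rw [← Nat.cast_sum, Nat.cast_le]
  refine (Finset.card_le_card fun ω hω => ?_).trans Finset.card_biUnion_le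
  simp only [Finset.mem_filter, Finset.mem_biUnion] at hω ⊢
  obtain ⟨hA, k, hk, hp⟩ := hω
  exact ⟨k, hk, hA, hp⟩

theorem freq_or_le : freq A (fun ω => p ω ∨ q ω) ≤ freq A p + freq A q := by
  classical
  rw [freq_eq, freq_eq, freq_eq, ← add_div, Finset.filter_or]
  gcongr 1
  exact_mod_cast Finset.card_union_le _ _

theorem freq_not (hA : A.Nonempty) : freq A (fun ω => ¬ p ω) = 1 - freq A p := by
  classical
  have hcard : (A.card : ℝ) ≠ 0 := by exact_mod_cast hA.card_ne_zero
  rw [eq_sub_iff_add_eq', freq_eq, freq_eq, ← add_div, div_eq_one_iff_eq hcard]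
  exact_mod_cast Finset.card_filter_add_card_filter_not p

theorem mul_freq_le_expect {f : Ω → ℝ} {a : ℝ} (hf : ∀ ω ∈ A, 0 ≤ f ω)
    (hp : ∀ ω ∈ A, p ω → a ≤ f ω) : a * freq A p ≤ 𝔼 ω ∈ A, f ω := by
  classical
  rw [freq, Finset.expect_eq_sum_div_card, mul_div_assoc']
  gcongr 1
  calc a * (A.filter p).card = ∑ _ω ∈ A.filter p, a := by
        rw [Finset.sum_const, nsmul_eq_mul, mul_comm]
    _ ≤ ∑ ω ∈ A.filter p, f ω :=
        Finset.sum_le_sum fun ω hω => hp ω (Finset.mem_filter.1 hω).1 (Finset.mem_filter.1 hω).2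
    _ ≤ ∑ ω ∈ A, f ω :=
        Finset.sum_le_sum_of_subset_of_nonneg (Finset.filter_subset p A) fun ω hω _ => hf ω hω

end Frequency

/-! ### The matrix Bernstein inequality -/

section QuadraticForms

open scoped Matrix.Norms.L2Operator MatrixOrder

theorem dotProduct_self_nonneg_real {ι : Type*} [Fintype ι] (x : ι → ℝ) : 0 ≤ x ⬝ᵥ x := by
  simpa using dotProduct_self_star_nonneg x

theorem norm_toLp_sq {ι : Type*} [Fintype ι] (x : ι → ℝ) : ‖WithLp.toLp 2 x‖ ^ 2 = x ⬝ᵥ x := by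
  rw [EuclideanSpace.real_norm_sq_eq]
  simp [dotProduct, sq]

variable {m n : Type*} [Fintype m] [Fintype n] [DecidableEq n] {c : ℝ}

theorem opNorm_le_iff_dotProduct_le {A : Matrix m n ℝ} (hc : 0 ≤ c) :
    ‖A‖ ≤ c ↔ ∀ x y, x ⬝ᵥ A *ᵥ y ≤ c * ((x ⬝ᵥ x + y ⬝ᵥ y) / 2) := by
  have hinner (x : m → ℝ) (y : n → ℝ) :
      x ⬝ᵥ A *ᵥ y = inner ℝ (WithLp.toLp 2 (A *ᵥ y)) (WithLp.toLp 2 x) := by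
    simp [EuclideanSpace.inner_eq_star_dotProduct]
  refine ⟨fun h x y => ?_, fun h => ?_⟩
  · have hcs := real_inner_le_norm (WithLp.toLp 2 (A *ᵥ y)) (WithLp.toLp 2 x)
    have hmul : ‖WithLp.toLp 2 (A *ᵥ y)‖ ≤ c * ‖WithLp.toLp 2 y‖ :=
      (Matrix.l2_opNorm_mulVec A (WithLp.toLp 2 y)).trans (by gcongr)
    rw [hinner, ← norm_toLp_sq, ← norm_toLp_sq]
    nlinarith [mul_le_mul_of_nonneg_right hmul (norm_nonneg (WithLp.toLp 2 x)),
      mul_nonneg hc (sq_nonneg (‖WithLp.toLp 2 x‖ - ‖WithLp.toLp 2 y‖))]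
  · rw [Matrix.l2_opNorm_def]
    refine ContinuousLinearMap.opNorm_le_of_re_inner_le hc fun y x hy hx => ?_
    have hxy := h x y
    rw [hinner, ← norm_toLp_sq, ← norm_toLp_sq, WithLp.toLp_ofLp, WithLp.toLp_ofLp, hx, hy] at hxy
    simpa [Matrix.toLpLin_apply] using hxy

theorem le_smul_one_iff_dotProduct_le {A : Matrix n n ℝ} (hA : A.IsSymm) :
    A ≤ c • 1 ↔ ∀ x, x ⬝ᵥ A *ᵥ x ≤ c * (x ⬝ᵥ x) := by
  rw [Matrix.le_iff, Matrix.posSemidef_iff_dotProduct_mulVec,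
    and_iff_right (Matrix.isHermitian_iff_isSymm.2 ((Matrix.isSymm_one.smul c).sub hA))]
  simp [Matrix.sub_mulVec, Matrix.smul_mulVec, dotProduct_sub]

theorem opNorm_le_iff_le_smul_one {A : Matrix n n ℝ} (hA : A.IsSymm) (hc : 0 ≤ c) :
    ‖A‖ ≤ c ↔ A ≤ c • 1 ∧ -A ≤ c • 1 := by
  rw [opNorm_le_iff_dotProduct_le hc, le_smul_one_iff_dotProduct_le hA,
    le_smul_one_iff_dotProduct_le hA.neg]
  refine ⟨fun h => ⟨fun x => ?_, fun x => ?_⟩, fun ⟨hle, hge⟩ x y => ?_⟩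
  · linarith [h x x]
  · have := h (-x) x
    simp only [neg_dotProduct, dotProduct_neg, neg_neg, Matrix.neg_mulVec] at this ⊢
    linarith
  · have hcomm : y ⬝ᵥ A *ᵥ x = x ⬝ᵥ A *ᵥ y := by
      rw [Matrix.dotProduct_mulVec, ← Matrix.mulVec_transpose, hA.eq, dotProduct_comm]
    have h1 := hle (x + y)
    have h2 := hge (x - y)
    simp only [Matrix.neg_mulVec, Matrix.mulVec_add, Matrix.mulVec_sub, add_dotProduct,
      sub_dotProduct, dotProduct_add, dotProduct_sub, dotProduct_neg, hcomm,
      dotProduct_comm y x] at h1 h2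
    linarith

end QuadraticForms

section Exponential

open NormedSpace
open scoped MatrixOrder Matrix.Norms.L2Operator

variable {D : Type*} [Fintype D] {A B C : Matrix D D ℝ}

theorem trace_mul_nonneg_of_nonneg (hA : 0 ≤ A) (hB : 0 ≤ B) : 0 ≤ (A * B).trace := by
  classical
  obtain ⟨R, rfl⟩ := CStarAlgebra.nonneg_iff_eq_star_mul_self.1 hA
  rw [Matrix.mul_assoc, Matrix.trace_mul_comm]
  exact ((Matrix.nonneg_iff_posSemidef.1 hB).mul_mul_conjTranspose_same R).trace_nonneg

theorem trace_mul_le_trace_mul (hA : 0 ≤ A) (h : B ≤ C) :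
    (A * B).trace ≤ (A * C).trace := by
  rw [← sub_nonneg, ← Matrix.trace_sub, ← mul_sub]
  exact trace_mul_nonneg_of_nonneg hA (sub_nonneg.2 h)

variable [DecidableEq D]

theorem le_smul_one_iff_spectrum_le (hA : A.IsSymm) {t : ℝ} :
    A ≤ t • 1 ↔ ∀ x ∈ spectrum ℝ A, x ≤ t := by
  rw [← Algebra.algebraMap_eq_smul_one]
  exact le_algebraMap_iff_spectrum_le (Matrix.isHermitian_iff_isSymm.2 hA)

theorem exp_nonneg_of_isSymm (hA : A.IsSymm) : 0 ≤ exp A :=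
  IsSelfAdjoint.exp_nonneg (Matrix.isHermitian_iff_isSymm.2 hA)

theorem exp_le_one_add_add_sq (hA : A.IsSymm) (hnorm : ‖A‖ ≤ 1) :
    exp A ≤ 1 + A + A * A := by
  have hsa : IsSelfAdjoint A := Matrix.isHermitian_iff_isSymm.2 hA
  obtain ⟨hle, hge⟩ := (opNorm_le_iff_le_smul_one hA zero_le_one).1 hnorm
  have hcfc : cfc (fun x : ℝ => 1 + x + x * x) A = 1 + A + A * A := by
    rw [cfc_add (a := A) (fun x : ℝ => 1 + x) (fun x => x * x), cfc_const_add 1 (fun x => x) A,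
      cfc_mul (fun x => x) (fun x => x) A, cfc_id' ℝ A, map_one]
  rw [← CFC.real_exp_eq_normedSpace_exp (a := A) hsa, ← hcfc]
  refine cfc_mono fun x hx => ?_
  have h1 : x ≤ 1 := (le_smul_one_iff_spectrum_le hA).1 hle x hx
  have h2 : -x ≤ 1 := (le_smul_one_iff_spectrum_le hA.neg).1 hge (-x)
    (by rw [← spectrum.neg_eq]; simpa using hx)
  have h3 := (le_abs_self _).trans (Real.abs_exp_sub_one_sub_id_le (abs_le.2 ⟨by linarith, h1⟩))
  linarith

theorem le_trace_of_mem_spectrum (hA : 0 ≤ A) {x : ℝ} (hx : x ∈ spectrum ℝ A) : x ≤ A.trace := by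
  have hpsd : A.PosSemidef := Matrix.nonneg_iff_posSemidef.1 hA
  rw [hpsd.isHermitian.spectrum_real_eq_range_eigenvalues] at hx
  obtain ⟨i, rfl⟩ := hx
  rw [hpsd.isHermitian.trace_eq_sum_eigenvalues]
  exact Finset.single_le_sum (fun j _ => hpsd.eigenvalues_nonneg j) (Finset.mem_univ i)

theorem exp_le_trace_exp (hA : A.IsSymm) {t : ℝ} (h : ¬ A ≤ t • 1) :
    Real.exp t ≤ (exp A).trace := by
  rw [le_smul_one_iff_spectrum_le hA] at h
  push Not at h
  obtain ⟨x, hx, htx⟩ := h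
  have hmem : Real.exp x ∈ spectrum ℝ (exp A) := by
    rw [Real.exp_eq_exp_ℝ]
    exact spectrum.exp_mem_exp A hx
  exact (Real.exp_le_exp.2 htx.le).trans (le_trace_of_mem_spectrum (exp_nonneg_of_isSymm hA) hmem)

end Exponential

section Bernstein

open NormedSpace
open scoped BigOperators MatrixOrder Matrix.Norms.L2Operator

variable {E : Type*} [Fintype E]

theorem expect_univ_cons {M : Type*} [AddCommMonoid M] [Module ℚ≥0 M] (s : ℕ)
    (f : (Fin (s + 1) → E) → M) :
    𝔼 ω, f ω = 𝔼 e, 𝔼 ω : Fin s → E, f (Fin.cons e ω) := by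
  rw [← Fintype.expect_equiv (Fin.consEquiv fun _ : Fin (s + 1) => E) _ f fun _ => rfl,
    ← Finset.univ_product_univ, Finset.expect_product]
  rfl

theorem isSymm_expect {D : Type*} {X : E → Matrix D D ℝ} (h : ∀ e, (X e).IsSymm) :
    (𝔼 e, X e).IsSymm :=
  (map_expect (Matrix.transposeLinearEquiv D D ℚ≥0 ℝ) X Finset.univ).trans
    (Finset.expect_congr rfl fun e _ => h e)

theorem isSymm_sum {ι D : Type*} (s : Finset ι) {X : ι → Matrix D D ℝ} (h : ∀ i, (X i).IsSymm) :
    (∑ i ∈ s, X i).IsSymm := by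
  rw [Matrix.IsSymm, Matrix.transpose_sum]
  exact Finset.sum_congr rfl fun i _ => h i

variable {D : Type*} [Fintype D] [DecidableEq D]

/-- The Laplace transform bound of Ahlswede and Winter. -/
theorem expect_trace_exp_add_sum_le {X : E → Matrix D D ℝ} (hX : ∀ e, (X e).IsSymm) {c : ℝ}
    (hc : 0 ≤ c) (h : 𝔼 e, exp (X e) ≤ c • 1) (s : ℕ) {S : Matrix D D ℝ} (hS : S.IsSymm) :
    𝔼 ω : Fin s → E, (exp (S + ∑ i, X (ω i))).trace ≤ c ^ s * (exp S).trace := by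
  induction s generalizing S with
  | zero => simp
  | succ s ih =>
    rw [expect_univ_cons]
    calc 𝔼 e, 𝔼 ω : Fin s → E, (exp (S + ∑ i, X (Fin.cons (α := fun _ => E) e ω i))).trace
        = 𝔼 e, 𝔼 ω : Fin s → E, (exp ((S + X e) + ∑ i, X (ω i))).trace := by
          simp only [Fin.sum_univ_succ, Fin.cons_zero, Fin.cons_succ, add_assoc]
      _ ≤ 𝔼 e, c ^ s * (exp S * exp (X e)).trace := by
          refine Finset.expect_le_expect fun e _ => (ih (hS.add (hX e))).trans ?_
          gcongr
          exact trace_exp_add_le hS (hX e)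
      _ = c ^ s * (exp S * 𝔼 e, exp (X e)).trace := by
          rw [← Finset.mul_expect, Finset.mul_expect _ _ (exp S)]
          exact congrArg _ (map_expect (Matrix.traceLinearMap D ℚ≥0 ℝ) _ _).symm
      _ ≤ c ^ s * (exp S * c • 1).trace := by
          gcongr
          exact trace_mul_le_trace_mul (exp_nonneg_of_isSymm hS) h
      _ = c ^ (s + 1) * (exp S).trace := by
          rw [mul_smul_comm, mul_one, Matrix.trace_smul, smul_eq_mul]
          ring

theorem expect_exp_le {X : E → Matrix D D ℝ} [Nonempty E] (hX : ∀ e, (X e).IsSymm)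
    (hmean : 𝔼 e, X e = 0) {v : ℝ} (hnorm : ∀ e, ‖X e‖ ≤ 1) (hvar : 𝔼 e, X e * X e ≤ v • 1) :
    𝔼 e, exp (X e) ≤ Real.exp v • 1 := by
  calc 𝔼 e, exp (X e) ≤ 𝔼 e, (1 + X e + X e * X e) :=
        Finset.expect_le_expect fun e _ => exp_le_one_add_add_sq (hX e) (hnorm e)
    _ = 1 + 𝔼 e, X e * X e := by
        rw [Finset.expect_add_distrib, Finset.expect_add_distrib, hmean, Fintype.expect_const,
          add_zero]
    _ ≤ (1 : ℝ) • 1 + v • 1 := by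
        rw [one_smul]
        gcongr
    _ ≤ Real.exp v • 1 := by
        rw [← add_smul]
        have := Real.add_one_le_exp v
        exact smul_le_smul_of_nonneg_right (by linarith) zero_le_one

theorem freq_not_sum_le_smul_one_le [Nonempty E] {X : E → Matrix D D ℝ}
    (hX : ∀ e, (X e).IsSymm) (hmean : 𝔼 e, X e = 0) {L t : ℝ} (hL : 0 < L) (ht : 0 < t)
    (ht1 : t ≤ 1) (hnorm : ∀ e, ‖X e‖ ≤ L) (hvar : 𝔼 e, X e * X e ≤ L • 1) (s : ℕ) :
    freq Finset.univ (fun ω : Fin s → E => ¬ ∑ i, X (ω i) ≤ (s * t) • 1)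
      ≤ Fintype.card D * Real.exp (-(s * t ^ 2 / (4 * L))) := by
  set θ : ℝ := t / (2 * L) with hθ
  have hθpos : 0 < θ := by positivity
  have hsym : ∀ e, (θ • X e).IsSymm := fun e => (hX e).smul θ
  have hmgf : 𝔼 e, exp (θ • X e) ≤ Real.exp (θ ^ 2 * L) • 1 := by
    refine expect_exp_le hsym ?_ (fun e => ?_) ?_
    · rw [← Finset.smul_expect, hmean, smul_zero]
    · rw [norm_smul, Real.norm_of_nonneg hθpos.le]
      calc θ * ‖X e‖ ≤ θ * L := by gcongr; exact hnorm e
        _ ≤ 1 := by rw [hθ]; field_simp; linarith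
    · simp only [smul_mul_smul_comm]
      rw [← Finset.smul_expect, ← sq, mul_smul]
      exact smul_le_smul_of_nonneg_left hvar (sq_nonneg θ)
  have hlaplace := expect_trace_exp_add_sum_le hsym (Real.exp_nonneg _) hmgf s Matrix.isSymm_zero
  rw [exp_zero, Matrix.trace_one] at hlaplace
  have hmarkov : Real.exp (θ * (s * t))
        * freq Finset.univ (fun ω : Fin s → E => ¬ ∑ i, X (ω i) ≤ (s * t) • 1)
      ≤ 𝔼 ω : Fin s → E, (exp (0 + ∑ i, θ • X (ω i))).trace := by
    refine mul_freq_le_expect (fun ω _ => ?_) fun ω _ hω => ?_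
    · rw [zero_add]
      exact (Matrix.nonneg_iff_posSemidef.1
        (exp_nonneg_of_isSymm (isSymm_sum _ fun i => hsym (ω i)))).trace_nonneg
    · rw [zero_add, ← Finset.smul_sum]
      refine exp_le_trace_exp ((isSymm_sum _ fun i => hX (ω i)).smul θ) fun hle => hω ?_
      rwa [mul_smul, smul_le_smul_iff_of_pos_left hθpos] at hle
  have hexp : Real.exp (θ ^ 2 * L) ^ s
      = Real.exp (-(s * t ^ 2 / (4 * L))) * Real.exp (θ * (s * t)) := by
    rw [← Real.exp_nat_mul, ← Real.exp_add]
    congr 1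
    rw [hθ]
    field_simp
    ring
  rw [hexp] at hlaplace
  refine le_of_mul_le_mul_left ((hmarkov.trans hlaplace).trans_eq ?_) (Real.exp_pos (θ * (s * t)))
  ring

theorem norm_sub_expect_le {V : Type*} [NormedAddCommGroup V] [NormedSpace ℝ V] [Module ℚ≥0 V]
    [Nonempty E] {Y : E → V} {c : ℝ} (h : ∀ e, ‖Y e‖ ≤ c) (e : E) : ‖Y e - 𝔼 e, Y e‖ ≤ 2 * c := by
  have hmean : ‖𝔼 e, Y e‖ ≤ c :=
    (Finset.le_expect_of_subadditive norm_zero norm_add_le fun q x => by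
      rw [← NNRat.cast_smul_eq_nnqsmul ℝ, ← NNRat.cast_smul_eq_nnqsmul ℝ, norm_smul,
        Real.norm_of_nonneg (NNRat.cast_nonneg _), smul_eq_mul]).trans
      (Finset.expect_le Finset.univ_nonempty fun e _ => h e)
  linarith [norm_sub_le (Y e) (𝔼 e, Y e), h e]

omit [DecidableEq D] in
theorem expect_sub_mul_self_le [Nonempty E] {Y : E → Matrix D D ℝ}
    (hY : ∀ e, (Y e).IsSymm) :
    𝔼 e, (Y e - 𝔼 e, Y e) * (Y e - 𝔼 e, Y e) ≤ 𝔼 e, Y e * Y e := by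
  classical
  set M := 𝔼 e, Y e
  have hsymm : Mᵀ = M := isSymm_expect hY
  have hnonneg : 0 ≤ M * M := by
    simpa [Matrix.star_eq_conjTranspose, hsymm] using star_mul_self_nonneg M
  have hexpand : 𝔼 e, (Y e - M) * (Y e - M) = (𝔼 e, Y e * Y e) - M * M := by
    have hleft : 𝔼 e, M * Y e = M * M := (Finset.mul_expect Finset.univ Y M).symm
    have hright : 𝔼 e, Y e * M = M * M := (Finset.expect_mul Finset.univ Y M).symm
    simp only [sub_mul, mul_sub, Finset.expect_sub_distrib, hleft, hright, Fintype.expect_const]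
    abel
  rw [hexpand]
  exact sub_le_self _ hnonneg

/-- The **matrix Bernstein inequality**. -/
theorem freq_not_norm_sum_sub_expect_le [Nonempty E] {Y : E → Matrix D D ℝ}
    (hY : ∀ e, (Y e).IsSymm) {L t : ℝ} (hL : 0 < L) (ht : 0 < t) (ht1 : t ≤ 1)
    (hnorm : ∀ e, ‖Y e‖ ≤ L / 2) (hvar : 𝔼 e, Y e * Y e ≤ L • 1) (s : ℕ) :
    freq Finset.univ (fun ω : Fin s → E => ¬ ‖∑ i, (Y (ω i) - 𝔼 e, Y e)‖ ≤ s * t)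
      ≤ 2 * (Fintype.card D * Real.exp (-(s * t ^ 2 / (4 * L)))) := by
  set Z : E → Matrix D D ℝ := fun e => Y e - 𝔼 e, Y e with hZ
  have hsymm : ∀ e, (Z e).IsSymm := fun e => (hY e).sub (isSymm_expect hY)
  have hmean : 𝔼 e, Z e = 0 := by
    rw [hZ, Finset.expect_sub_distrib, Fintype.expect_const, sub_self]
  have hZnorm : ∀ e, ‖Z e‖ ≤ L := fun e => (norm_sub_expect_le hnorm e).trans_eq (by ring)
  have hZvar : 𝔼 e, Z e * Z e ≤ L • 1 := (expect_sub_mul_self_le hY).trans hvar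
  have hupper := freq_not_sum_le_smul_one_le hsymm hmean hL ht ht1 hZnorm hZvar s
  have hlower := freq_not_sum_le_smul_one_le (X := fun e => -Z e) (fun e => (hsymm e).neg)
    (by rw [Finset.expect_neg_distrib, hmean, neg_zero]) hL ht ht1
    (fun e => (norm_neg _).trans_le (hZnorm e)) (by simpa only [neg_mul_neg] using hZvar) s
  calc _ ≤ freq Finset.univ fun ω : Fin s → E =>
          ¬ ∑ i, Z (ω i) ≤ (s * t) • 1 ∨ ¬ ∑ i, -Z (ω i) ≤ (s * t) • 1 := by
        refine freq_mono fun ω _ hω => ?_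
        rw [← not_and_or, Finset.sum_neg_distrib]
        exact fun h => hω ((opNorm_le_iff_le_smul_one (isSymm_sum _ fun i => hsymm (ω i))
          (by positivity)).2 h)
    _ ≤ _ := freq_or_le.trans (by linarith)

theorem freq_not_abs_sum_sub_expect_le [Nonempty E] {f : E → ℝ} {L t : ℝ} (hL : 0 < L)
    (ht : 0 < t) (ht1 : t ≤ 1) (hf : ∀ e, |f e| ≤ L / 2) (hvar : 𝔼 e, f e ^ 2 ≤ L) (s : ℕ) :
    freq Finset.univ (fun ω : Fin s → E => ¬ |∑ i, (f (ω i) - 𝔼 e, f e)| ≤ s * t)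
      ≤ 2 * Real.exp (-(s * t ^ 2 / (4 * L))) := by
  have hexpect (g : E → ℝ) : 𝔼 e, g e • (1 : Matrix Unit Unit ℝ) = (𝔼 e, g e) • 1 :=
    (map_expect ((LinearMap.toSpanSingleton ℝ (Matrix Unit Unit ℝ) 1).restrictScalars ℚ≥0)
      g Finset.univ).symm
  have hbern := freq_not_norm_sum_sub_expect_le (Y := fun e => f e • (1 : Matrix Unit Unit ℝ))
    (fun e => Matrix.isSymm_one.smul _) hL ht ht1
    (fun e => by rw [norm_smul, norm_one, mul_one]; exact hf e)
    (by
      simp_rw [smul_mul_smul_comm, mul_one, ← sq]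
      rw [hexpect]
      exact smul_le_smul_of_nonneg_right hvar zero_le_one) s
  simpa only [hexpect, ← sub_smul, ← Finset.sum_smul, norm_smul, norm_one, mul_one,
    Real.norm_eq_abs, Fintype.card_unit, Nat.cast_one, one_mul] using hbern

end Bernstein

section RectangularBernstein

open scoped BigOperators MatrixOrder Matrix.Norms.L2Operator

variable {m n : Type*}

/-- The Hermitian dilation of a rectangular matrix, which reduces the rectangular Bernstein
inequality to the symmetric one. -/
def dilation : Matrix m n ℝ →ₗ[ℝ] Matrix (m ⊕ n) (m ⊕ n) ℝ where
  toFun A := Matrix.fromBlocks 0 A Aᵀ 0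
  map_add' A B := by simp [Matrix.fromBlocks_add]
  map_smul' c A := by simp [Matrix.fromBlocks_smul]

theorem dilation_apply (A : Matrix m n ℝ) : dilation A = Matrix.fromBlocks 0 A Aᵀ 0 := rfl

theorem dilation_isSymm (A : Matrix m n ℝ) : (dilation A).IsSymm := by
  simp [dilation_apply, Matrix.IsSymm, Matrix.fromBlocks_transpose]

variable [Fintype m] [Fintype n]

theorem dilation_mul_self (A : Matrix m n ℝ) :
    dilation A * dilation A = Matrix.fromBlocks (A * Aᵀ) 0 0 (Aᵀ * A) := by
  simp [dilation_apply, Matrix.fromBlocks_multiply]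

variable [DecidableEq m] [DecidableEq n]

theorem norm_dilation_le_iff {A : Matrix m n ℝ} {c : ℝ} (hc : 0 ≤ c) :
    ‖dilation A‖ ≤ c ↔ ‖A‖ ≤ c := by
  have hdot (x y : m ⊕ n → ℝ) : x ⬝ᵥ dilation A *ᵥ y
      = (x ∘ Sum.inl) ⬝ᵥ A *ᵥ (y ∘ Sum.inr) + (y ∘ Sum.inl) ⬝ᵥ A *ᵥ (x ∘ Sum.inr) := by
    rw [dilation_apply, Matrix.fromBlocks_mulVec, ← Sum.elim_comp_inl_inr x,
      sumElim_dotProduct_sumElim, Sum.elim_comp_inl, Sum.elim_comp_inr, Matrix.zero_mulVec,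
      Matrix.zero_mulVec, zero_add, add_zero, Matrix.mulVec_transpose,
      dotProduct_comm (x ∘ Sum.inr), Matrix.dotProduct_mulVec (y ∘ Sum.inl)]
  have hsq (x : m ⊕ n → ℝ) :
      x ⬝ᵥ x = (x ∘ Sum.inl) ⬝ᵥ (x ∘ Sum.inl) + (x ∘ Sum.inr) ⬝ᵥ (x ∘ Sum.inr) := by
    simp [dotProduct]
  rw [opNorm_le_iff_dotProduct_le hc, opNorm_le_iff_dotProduct_le hc]
  refine ⟨fun h x y => ?_, fun h x y => ?_⟩
  · simpa [hdot, hsq, Sum.elim_comp_inl, Sum.elim_comp_inr] using h (Sum.elim x 0) (Sum.elim 0 y)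
  · rw [hdot, hsq x, hsq y]
    linarith [h (x ∘ Sum.inl) (y ∘ Sum.inr), h (y ∘ Sum.inl) (x ∘ Sum.inr)]

theorem expect_dilation_mul_self_le {E : Type*} [Fintype E] {B : E → Matrix m n ℝ} {c : ℝ}
    (hleft : 𝔼 e, B e * (B e)ᵀ ≤ c • 1) (hright : 𝔼 e, (B e)ᵀ * B e ≤ c • 1) :
    𝔼 e, dilation (B e) * dilation (B e) ≤ c • 1 := by
  have hleftSymm : (𝔼 e, B e * (B e)ᵀ).IsSymm := isSymm_expect fun e => by simp [Matrix.IsSymm]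
  have hrightSymm : (𝔼 e, (B e)ᵀ * B e).IsSymm := isSymm_expect fun e => by simp [Matrix.IsSymm]
  have hexpect : 𝔼 e, dilation (B e) * dilation (B e)
      = Matrix.fromBlocks (𝔼 e, B e * (B e)ᵀ) 0 0 (𝔼 e, (B e)ᵀ * B e) := by
    simp only [dilation_mul_self]
    ext (i | i) (j | j) <;> simp [Finset.expect, Matrix.sum_apply]
  rw [hexpect, le_smul_one_iff_dotProduct_le (hleftSymm.fromBlocks (by simp) hrightSymm)]
  intro x
  rw [← Sum.elim_comp_inl_inr x, Matrix.fromBlocks_mulVec, sumElim_dotProduct_sumElim,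
    sumElim_dotProduct_sumElim]
  simp only [Sum.elim_comp_inl, Sum.elim_comp_inr, Matrix.zero_mulVec, add_zero, zero_add]
  linarith [(le_smul_one_iff_dotProduct_le hleftSymm).1 hleft (x ∘ Sum.inl),
    (le_smul_one_iff_dotProduct_le hrightSymm).1 hright (x ∘ Sum.inr)]

theorem freq_not_norm_sum_sub_expect_le_of_rect {E : Type*} [Fintype E] [Nonempty E]
    {B : E → Matrix m n ℝ} {L t : ℝ} (hL : 0 < L) (ht : 0 < t) (ht1 : t ≤ 1)
    (hnorm : ∀ e, ‖B e‖ ≤ L / 2) (hleft : 𝔼 e, B e * (B e)ᵀ ≤ L • 1)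
    (hright : 𝔼 e, (B e)ᵀ * B e ≤ L • 1) (s : ℕ) :
    freq Finset.univ (fun ω : Fin s → E => ¬ ‖∑ i, (B (ω i) - 𝔼 e, B e)‖ ≤ s * t)
      ≤ 2 * ((Fintype.card m + Fintype.card n) * Real.exp (-(s * t ^ 2 / (4 * L)))) := by
  have hbern := freq_not_norm_sum_sub_expect_le (Y := fun e => dilation (B e))
    (fun e => dilation_isSymm _) hL ht ht1
    (fun e => (norm_dilation_le_iff (by positivity)).2 (hnorm e))
    (expect_dilation_mul_self_le hleft hright) s
  have hexpect : 𝔼 e, dilation (B e) = dilation (𝔼 e, B e) :=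
    (map_expect (dilation.restrictScalars ℚ≥0) B Finset.univ).symm
  simpa only [hexpect, ← map_sub, ← map_sum,
    norm_dilation_le_iff (mul_nonneg (Nat.cast_nonneg s) ht.le), Fintype.card_sum,
    Nat.cast_add] using hbern

end RectangularBernstein

/-! ### Singular value decompositions and the nuclear norm -/

section SingularBasis

open scoped Matrix.Norms.L2Operator

variable {α β : Type*} [Fintype α] [Fintype β] [DecidableEq β]

omit [Fintype β] [DecidableEq β] in
theorem orthonormal_iff_transpose_mul_self {κ : Type*} [DecidableEq κ]
    {v : κ → EuclideanSpace ℝ α} :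
    Orthonormal ℝ v ↔ (Matrix.of fun a k => v k a)ᵀ * (Matrix.of fun a k => v k a) = 1 := by
  rw [orthonormal_iff_ite, ← Matrix.ext_iff]
  simp [Matrix.mul_apply, Matrix.one_apply, PiLp.inner_apply, mul_comm]

/-- An orthonormal basis of right singular vectors of `M`, in the order of the singular values. -/
noncomputable def rightSingularBasis (M : Matrix α β ℝ) :
    OrthonormalBasis (Fin (Fintype.card β)) ℝ (EuclideanSpace ℝ β) :=
  (Matrix.toEuclideanLin M).isSymmetric_adjoint_comp_self.eigenvectorBasis finrank_euclideanSpace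

variable (M : Matrix α β ℝ)

theorem inner_map_rightSingularBasis (i j : Fin (Fintype.card β)) :
    inner ℝ (Matrix.toEuclideanLin M (rightSingularBasis M i))
        (Matrix.toEuclideanLin M (rightSingularBasis M j))
      = if i = j then (Matrix.toEuclideanLin M).singularValues i ^ 2 else 0 := by
  set f := Matrix.toEuclideanLin M
  have heig : (LinearMap.adjoint f ∘ₗ f) (rightSingularBasis M i)
      = f.singularValues i ^ 2 • rightSingularBasis M i := by
    rw [f.sq_singularValues_fin finrank_euclideanSpace]
    exact f.isSymmetric_adjoint_comp_self.apply_eigenvectorBasis finrank_euclideanSpace i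
  rw [← LinearMap.adjoint_inner_left, ← LinearMap.comp_apply, heig, real_inner_smul_left,
    orthonormal_iff_ite.1 (rightSingularBasis M).orthonormal, mul_ite, mul_one, mul_zero]

theorem map_rightSingularBasis_eq_zero {j : Fin (Fintype.card β)}
    (hj : Module.finrank ℝ (Matrix.toEuclideanLin M).range ≤ j) :
    Matrix.toEuclideanLin M (rightSingularBasis M j) = 0 := by
  rw [← inner_self_eq_zero (𝕜 := ℝ), inner_map_rightSingularBasis, if_pos rfl,
    (LinearMap.singularValues_eq_zero_iff_le_finrank_range _).2 hj, zero_pow two_ne_zero]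

theorem apply_eq_sum_rightSingularBasis (a : α) (b : β) :
    M a b = ∑ j, Matrix.toEuclideanLin M (rightSingularBasis M j) a * rightSingularBasis M j b := by
  have hcol : M a b = Matrix.toEuclideanLin M (EuclideanSpace.single b 1) a := by
    simp [Matrix.toLpLin_apply, Matrix.mulVec_single]
  rw [hcol, ← (rightSingularBasis M).sum_repr (EuclideanSpace.single b 1), map_sum]
  simp [OrthonormalBasis.repr_apply_apply, EuclideanSpace.inner_single_right, mul_comm]

end SingularBasis

section Nuclear

open scoped Matrix.Norms.L2Operator

variable {α β : Type} [Fintype α] [DecidableEq α] [Fintype β] [DecidableEq β]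

omit [Fintype α] [DecidableEq α] in
theorem finrank_range_toEuclideanLin_le (M : Matrix α β ℝ) :
    Module.finrank ℝ (Matrix.toEuclideanLin M).range ≤ Fintype.card β :=
  (LinearMap.finrank_range_le _).trans_eq finrank_euclideanSpace

/-- The compact singular value decomposition whose columns are the right singular vectors of
`rightSingularBasis` with positive singular value, and their normalized images. -/
noncomputable def singularSVD (M : Matrix α β ℝ) : CompactSVD M where
  rk := Module.finrank ℝ (Matrix.toEuclideanLin M).range
  U := Matrix.of fun a k => (((Matrix.toEuclideanLin M).singularValues k)⁻¹ •
    Matrix.toEuclideanLin M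
      (rightSingularBasis M (Fin.castLE (finrank_range_toEuclideanLin_le M) k))) a
  s k := (Matrix.toEuclideanLin M).singularValues k
  V := Matrix.of fun b k =>
    rightSingularBasis M (Fin.castLE (finrank_range_toEuclideanLin_le M) k) b
  s_pos k := (LinearMap.singularValues_pos_iff_lt_finrank_range _).2 k.2
  U_orth := by
    rw [← orthonormal_iff_transpose_mul_self, orthonormal_iff_ite]
    intro k l
    have hpos : 0 < (Matrix.toEuclideanLin M).singularValues k :=
      (LinearMap.singularValues_pos_iff_lt_finrank_range _).2 k.2
    rw [real_inner_smul_left, real_inner_smul_right, inner_map_rightSingularBasis]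
    simp only [(Fin.castLE_injective (finrank_range_toEuclideanLin_le M)).eq_iff]
    split_ifs with hkl
    · subst hkl
      rw [Fin.val_castLE]
      field_simp
    · simp
  V_orth := orthonormal_iff_transpose_mul_self.1
    ((rightSingularBasis M).orthonormal.comp _ (Fin.castLE_injective _))
  eq := by
    ext a b
    rw [apply_eq_sum_rightSingularBasis M, Matrix.mul_apply]
    have hterm (k : Fin (Module.finrank ℝ (Matrix.toEuclideanLin M).range)) (x y : ℝ) :
        ((Matrix.toEuclideanLin M).singularValues k)⁻¹ * x
          * (Matrix.toEuclideanLin M).singularValues k * y = x * y := by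
      have := ((Matrix.toEuclideanLin M).singularValues_pos_iff_lt_finrank_range).2 k.2
      field_simp
    simp only [Matrix.mul_diagonal, Matrix.of_apply, Matrix.transpose_apply, PiLp.smul_apply,
      smul_eq_mul, hterm]
    refine (Fintype.sum_of_injective _ (Fin.castLE_injective (finrank_range_toEuclideanLin_le M))
      _ _ (fun j hj => ?_) fun k => rfl).symm
    rw [map_rightSingularBasis_eq_zero M (not_lt.1 fun hlt => hj ⟨⟨j, hlt⟩, rfl⟩), PiLp.zero_apply,
      zero_mul]

theorem sum_s_singularSVD (M : Matrix α β ℝ) : ∑ k, (singularSVD M).s k = nuclearNorm M := by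
  rw [nuclearNorm, Finsupp.sum, LinearMap.support_singularValues]
  exact Fin.sum_univ_eq_sum_range (fun i : ℕ => (Matrix.toEuclideanLin M).singularValues i) _

theorem mulVec_dotProduct_mulVec_self {ι κ : Type*} [Fintype ι] [Fintype κ] (A : Matrix ι κ ℝ)
    (x : κ → ℝ) : (A *ᵥ x) ⬝ᵥ (A *ᵥ x) = x ⬝ᵥ (Aᵀ * A) *ᵥ x := by
  rw [← Matrix.mulVec_mulVec, Matrix.dotProduct_mulVec x, Matrix.vecMul_transpose]

theorem dotProduct_self_eq_add_of_orth {α κ : Type*} [Fintype α] [DecidableEq α] [Fintype κ]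
    [DecidableEq κ] {U : Matrix α κ ℝ} (hU : Uᵀ * U = 1) (x : α → ℝ) :
    x ⬝ᵥ x = (Uᵀ *ᵥ x) ⬝ᵥ (Uᵀ *ᵥ x) + ((1 - U * Uᵀ) *ᵥ x) ⬝ᵥ ((1 - U * Uᵀ) *ᵥ x) := by
  have hidem : U * Uᵀ * (U * Uᵀ) = U * Uᵀ := by
    rw [Matrix.mul_assoc, ← Matrix.mul_assoc Uᵀ, hU, Matrix.one_mul]
  have hsum : (Uᵀ)ᵀ * Uᵀ + (1 - U * Uᵀ)ᵀ * (1 - U * Uᵀ) = 1 := by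
    simp only [Matrix.transpose_sub, Matrix.transpose_one, Matrix.transpose_mul,
      Matrix.transpose_transpose, sub_mul, mul_sub, one_mul, mul_one, hidem]
    abel
  rw [mulVec_dotProduct_mulVec_self, mulVec_dotProduct_mulVec_self, ← dotProduct_add,
    ← Matrix.add_mulVec, hsum, Matrix.one_mulVec]

namespace CompactSVD

variable {M : Matrix α β ℝ} (S : CompactSVD M)

omit [DecidableEq α] [DecidableEq β] in
theorem trace_transpose_mul (W : Matrix α β ℝ) :
    (Wᵀ * M).trace = ∑ k, S.U.col k ⬝ᵥ W *ᵥ S.V.col k * S.s k := by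
  have hcycle : (Wᵀ * M).trace = (S.Vᵀ * Wᵀ * S.U * Matrix.diagonal S.s).trace := by
    conv_lhs => rw [S.eq]
    rw [← Matrix.mul_assoc, Matrix.trace_mul_comm, ← Matrix.mul_assoc, ← Matrix.mul_assoc]
  rw [hcycle, Matrix.trace]
  refine Finset.sum_congr rfl fun k _ => ?_
  rw [Matrix.diag_apply, Matrix.mul_diagonal, ← Matrix.transpose_mul, Matrix.mul_apply',
    dotProduct_comm]
  rfl

omit [DecidableEq α] in
theorem trace_transpose_mul_le {W : Matrix α β ℝ} (hW : ‖W‖ ≤ 1) :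
    (Wᵀ * M).trace ≤ ∑ k, S.s k := by
  rw [S.trace_transpose_mul]
  refine Finset.sum_le_sum fun k _ => mul_le_of_le_one_left (S.s_pos k).le ?_
  have hU : S.U.col k ⬝ᵥ S.U.col k = 1 :=
    (congrFun (congrFun S.U_orth k) k).trans (Matrix.one_apply_eq k)
  have hV : S.V.col k ⬝ᵥ S.V.col k = 1 :=
    (congrFun (congrFun S.V_orth k) k).trans (Matrix.one_apply_eq k)
  have hbound := (opNorm_le_iff_dotProduct_le zero_le_one).1 hW (S.U.col k) (S.V.col k)
  rw [hU, hV] at hbound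
  linarith

omit [DecidableEq α] [DecidableEq β] in
theorem trace_UV : ((S.U * S.Vᵀ)ᵀ * M).trace = ∑ k, S.s k := by
  have hcancel : (S.U * S.Vᵀ)ᵀ * M = S.V * (S.Uᵀ * S.U) * Matrix.diagonal S.s * S.Vᵀ := by
    refine (congrArg ((S.U * S.Vᵀ)ᵀ * ·) S.eq).trans ?_
    simp only [Matrix.transpose_mul, Matrix.transpose_transpose, Matrix.mul_assoc]
  rw [hcancel, S.U_orth, Matrix.mul_one, Matrix.trace_mul_comm, ← Matrix.mul_assoc, S.V_orth,
    Matrix.one_mul, Matrix.trace_diagonal]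

theorem norm_UV_add_le {W : Matrix α β ℝ} (hW : ‖W‖ ≤ 1)
    (hperp : (1 - S.U * S.Uᵀ) * W * (1 - S.V * S.Vᵀ) = W) : ‖S.U * S.Vᵀ + W‖ ≤ 1 := by
  rw [opNorm_le_iff_dotProduct_le zero_le_one] at hW ⊢
  intro x y
  have hrange : x ⬝ᵥ (S.U * S.Vᵀ) *ᵥ y
      ≤ ((S.Uᵀ *ᵥ x) ⬝ᵥ (S.Uᵀ *ᵥ x) + (S.Vᵀ *ᵥ y) ⬝ᵥ (S.Vᵀ *ᵥ y)) / 2 := by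
    rw [← Matrix.mulVec_mulVec, Matrix.dotProduct_mulVec x, ← Matrix.mulVec_transpose]
    have hsq := dotProduct_self_nonneg_real (S.Uᵀ *ᵥ x - S.Vᵀ *ᵥ y)
    simp only [sub_dotProduct, dotProduct_sub, dotProduct_comm (S.Vᵀ *ᵥ y)] at hsq
    linarith
  have hcompl : x ⬝ᵥ W *ᵥ y = ((1 - S.U * S.Uᵀ) *ᵥ x) ⬝ᵥ W *ᵥ ((1 - S.V * S.Vᵀ) *ᵥ y) := by
    conv_lhs => rw [← hperp]
    rw [← Matrix.mulVec_mulVec, ← Matrix.mulVec_mulVec, Matrix.dotProduct_mulVec x,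
      ← Matrix.mulVec_transpose]
    simp [Matrix.transpose_sub, Matrix.transpose_mul]
  rw [Matrix.add_mulVec, dotProduct_add, dotProduct_self_eq_add_of_orth S.U_orth x,
    dotProduct_self_eq_add_of_orth S.V_orth y, hcompl]
  linarith [hW ((1 - S.U * S.Uᵀ) *ᵥ x) ((1 - S.V * S.Vᵀ) *ᵥ y)]

omit [DecidableEq α] in
theorem norm_UV_le : ‖S.U * S.Vᵀ‖ ≤ 1 := by
  classical
  simpa using S.norm_UV_add_le (W := 0) (by simp) (by simp)

theorem sum_s_eq_nuclearNorm : ∑ k, S.s k = nuclearNorm M := by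
  rw [← sum_s_singularSVD]
  refine le_antisymm ?_ ?_
  · rw [← S.trace_UV]
    exact (singularSVD M).trace_transpose_mul_le S.norm_UV_le
  · rw [← (singularSVD M).trace_UV]
    exact S.trace_transpose_mul_le (singularSVD M).norm_UV_le

/-- The decomposition of the matrix with relabelled rows and columns, which shows that the nuclear
norm does not depend on the labelling. -/
def reindex {α' β' : Type} [Fintype α'] [Fintype β'] (e : α' ≃ α) (f : β' ≃ β) :
    CompactSVD (M.submatrix e f) where
  rk := S.rk
  U := S.U.submatrix e id
  s := S.s
  V := S.V.submatrix f id
  s_pos := S.s_pos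
  U_orth := by
    rw [Matrix.transpose_submatrix, Matrix.submatrix_mul_equiv, S.U_orth, Matrix.submatrix_id_id]
  V_orth := by
    rw [Matrix.transpose_submatrix, Matrix.submatrix_mul_equiv, S.V_orth, Matrix.submatrix_id_id]
  eq := by
    conv_lhs => rw [S.eq]
    ext a b
    simp [Matrix.mul_apply, Matrix.diagonal_apply]

end CompactSVD

theorem trace_transpose_mul_le_nuclearNorm {M W : Matrix α β ℝ} (hW : ‖W‖ ≤ 1) :
    (Wᵀ * M).trace ≤ nuclearNorm M :=
  sum_s_singularSVD M ▸ (singularSVD M).trace_transpose_mul_le hW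

theorem nuclearNorm_submatrix {α' β' : Type} [Fintype α'] [DecidableEq α'] [Fintype β']
    [DecidableEq β'] (M : Matrix α β ℝ) (e : α' ≃ α) (f : β' ≃ β) :
    nuclearNorm (M.submatrix e f) = nuclearNorm M := by
  rw [← sum_s_singularSVD M, ← ((singularSVD M).reindex e f).sum_s_eq_nuclearNorm]
  rfl

end Nuclear

/-! ### Sampling entries with replacement -/

section Sampling

open scoped BigOperators MatrixOrder Matrix.Norms.L2Operator

variable {E : Type*} [Fintype E] [DecidableEq E] {s : ℕ}

/-- The operator that keeps the coordinates `ω 0, …, ω (s - 1)` of a vector (with multiplicity) and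
kills the others, scaled so that its mean over all `ω` is the identity. -/
noncomputable def sampleOp (ω : Fin s → E) : Matrix E E ℝ :=
  ((Fintype.card E : ℝ) / s) • ∑ i, Matrix.single (ω i) (ω i) 1

theorem sampleOp_isSymm (ω : Fin s → E) : (sampleOp ω).IsSymm :=
  (isSymm_sum _ fun _ => Matrix.transpose_single _ _ _).smul _

theorem single_one_mulVec (e : E) (x : E → ℝ) :
    Matrix.single e e 1 *ᵥ x = Pi.single e (x e) := by
  rw [Matrix.single_mulVec, one_mul, Pi.single]

theorem sampleOp_mulVec_apply_eq_zero {ω : Fin s → E} {e : E} (he : ∀ i, ω i ≠ e) (x : E → ℝ) :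
    (sampleOp ω *ᵥ x) e = 0 := by
  simp [sampleOp, Matrix.smul_mulVec, Matrix.sum_mulVec, single_one_mulVec,
    Pi.single_eq_of_ne (he _).symm]

theorem expect_card_smul_map_single [Nonempty E] {V : Type*} [AddCommGroup V] [Module ℝ V]
    [Module ℚ≥0 V] (φ : Matrix E E ℝ →ₗ[ℝ] V) :
    𝔼 e, (Fintype.card E : ℝ) • φ (Matrix.single e e 1) = φ 1 := by
  have hcard : (Fintype.card E : ℚ≥0) ≠ 0 := by exact_mod_cast Fintype.card_ne_zero
  have hone : ∑ e : E, Matrix.single e e (1 : ℝ) = 1 := by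
    ext i j
    simp [Matrix.sum_apply, Matrix.single_apply, Matrix.one_apply, ite_and]
  rw [Finset.expect, ← Finset.smul_sum, ← map_sum, hone, Nat.cast_smul_eq_nsmul,
    ← Nat.cast_smul_eq_nsmul ℚ≥0, smul_smul, Finset.card_univ, inv_mul_cancel₀ hcard, one_smul]

theorem norm_map_sampleOp_sub_le_iff [Nonempty E] {V : Type*} [NormedAddCommGroup V]
    [NormedSpace ℝ V] [Module ℚ≥0 V] (hs : 0 < s) (φ : Matrix E E ℝ →ₗ[ℝ] V) (ω : Fin s → E)
    (t : ℝ) :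
    ‖φ (sampleOp ω) - φ 1‖ ≤ t ↔
      ‖∑ i, ((Fintype.card E : ℝ) • φ (Matrix.single (ω i) (ω i) 1)
        - 𝔼 e, (Fintype.card E : ℝ) • φ (Matrix.single e e 1))‖ ≤ s * t := by
  have hs' : (0 : ℝ) < s := by exact_mod_cast hs
  have hsum : ∑ i, ((Fintype.card E : ℝ) • φ (Matrix.single (ω i) (ω i) 1) - φ 1)
      = (s : ℝ) • (φ (sampleOp ω) - φ 1) := by
    rw [sampleOp, map_smul, map_sum, smul_sub, smul_smul, mul_div_cancel₀ _ hs'.ne',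
      Finset.sum_sub_distrib, ← Finset.smul_sum, Finset.sum_const, Finset.card_univ,
      Fintype.card_fin, Nat.cast_smul_eq_nsmul ℝ s]
  rw [expect_card_smul_map_single, hsum, norm_smul, Real.norm_natCast,
    mul_le_mul_iff_right₀ hs']

omit [DecidableEq E] in
theorem exists_abs_le_one_norm_smul_eq (w : E → ℝ) :
    ∃ v : E → ℝ, (∀ e, |v e| ≤ 1) ∧ ‖w‖ • v = w := by
  refine ⟨‖w‖⁻¹ • w, fun e => ?_, ?_⟩
  · rw [Pi.smul_apply, smul_eq_mul, abs_mul, abs_inv, abs_norm]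
    exact inv_mul_le_one_of_le₀ (norm_le_pi_norm w e) (norm_nonneg w)
  · rcases eq_or_ne w 0 with rfl | hw
    · simp
    · rw [smul_smul, mul_inv_cancel₀ (norm_ne_zero_iff.2 hw), one_smul]

variable {P : Matrix E E ℝ}

omit [DecidableEq E] in
theorem isSymm_of_isStarProjection (hP : IsStarProjection P) : P.IsSymm := by
  rw [Matrix.IsSymm, ← Matrix.conjTranspose_eq_transpose_of_trivial]
  exact hP.isSelfAdjoint.star_eq

omit [DecidableEq E] in
theorem sum_mul_apply_of_isStarProjection (hP : IsStarProjection P) (e f : E) :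
    ∑ g, P e g * P f g = P e f := by
  conv_rhs => rw [← hP.isIdempotentElem.eq, Matrix.mul_apply]
  exact Finset.sum_congr rfl fun g _ => by rw [(isSymm_of_isStarProjection hP).apply g f]

omit [DecidableEq E] in
theorem apply_self_nonneg_of_isStarProjection (hP : IsStarProjection P) (e : E) : 0 ≤ P e e := by
  rw [← sum_mul_apply_of_isStarProjection hP]
  exact Finset.sum_nonneg fun g _ => mul_self_nonneg _

omit [DecidableEq E] in
theorem abs_apply_le_of_isStarProjection (hP : IsStarProjection P) {κ : ℝ}
    (hκ : ∀ e, P e e ≤ κ) (e f : E) : |P e f| ≤ κ := by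
  have he := apply_self_nonneg_of_isStarProjection hP e
  have hcs := Finset.sum_mul_sq_le_sq_mul_sq Finset.univ (P e) (P f)
  simp only [sq (P _ _), sum_mul_apply_of_isStarProjection hP] at hcs
  refine abs_le_of_sq_le_sq ?_ (he.trans (hκ e))
  rw [sq, sq]
  exact hcs.trans (mul_le_mul (hκ e) (hκ f)
    (apply_self_nonneg_of_isStarProjection hP f) (he.trans (hκ e)))

theorem single_mul_mul_single_self (e : E) :
    Matrix.single e e 1 * P * Matrix.single e e 1 = P e e • Matrix.single e e 1 := by
  rw [Matrix.single_mul_mul_single, one_mul, mul_one, Matrix.smul_single, smul_eq_mul, mul_one]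

theorem conj_single_mul_self_of_isStarProjection (hP : IsStarProjection P) (e : E) :
    P * Matrix.single e e 1 * P * (P * Matrix.single e e 1 * P)
      = P e e • (P * Matrix.single e e 1 * P) := by
  calc _ = P * (Matrix.single e e 1 * (P * P) * Matrix.single e e 1) * P := by
        simp only [mul_assoc]
    _ = _ := by
        rw [hP.isIdempotentElem.eq, single_mul_mul_single_self, Matrix.mul_smul, Matrix.smul_mul]

theorem conj_single_nonneg_of_isStarProjection (hP : IsStarProjection P) (e : E) :
    0 ≤ P * Matrix.single e e 1 * P := by
  have hsingle : IsStarProjection (Matrix.single e e (1 : ℝ)) :=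
    ⟨by simp [IsIdempotentElem], by simp [IsSelfAdjoint, Matrix.star_eq_conjTranspose]⟩
  exact hP.isSelfAdjoint.conjugate_nonneg hsingle.nonneg

theorem norm_conj_single_le_of_isStarProjection (hP : IsStarProjection P) (e : E) :
    ‖P * Matrix.single e e 1 * P‖ ≤ P e e := by
  set A := P * Matrix.single e e 1 * P
  have hA : IsSelfAdjoint A :=
    IsSelfAdjoint.of_nonneg (conj_single_nonneg_of_isStarProjection hP e)
  have hsq : ‖A‖ * ‖A‖ = P e e * ‖A‖ := by
    rw [← sq, ← hA.norm_mul_self, conj_single_mul_self_of_isStarProjection hP, norm_smul,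
      Real.norm_of_nonneg (apply_self_nonneg_of_isStarProjection hP e)]
  rcases (norm_nonneg A).eq_or_lt with h0 | hpos
  · exact h0 ▸ apply_self_nonneg_of_isStarProjection hP e
  · exact (mul_right_cancel₀ hpos.ne' hsq).le

theorem freq_not_norm_mul_sampleOp_mul_sub_le [Nonempty E] (hP : IsStarProjection P) {L : ℝ}
    (hL : 0 < L) (hκ : ∀ e, Fintype.card E * P e e ≤ L / 2) (hs : 0 < s) :
    freq Finset.univ (fun ω : Fin s → E => ¬ ‖P * sampleOp ω * P - P‖ ≤ 1 / 2)
      ≤ 2 * (Fintype.card E * Real.exp (-(s / (16 * L)))) := by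
  set N : ℝ := (Fintype.card E : ℝ) with hN
  set Y : E → Matrix E E ℝ := fun e => N • (P * Matrix.single e e 1 * P) with hY
  have hsymm (e : E) : (Y e).IsSymm := by
    simp [Y, Matrix.IsSymm, (isSymm_of_isStarProjection hP).eq, mul_assoc]
  have hmean : 𝔼 e, Y e = P := by
    simpa [hP.isIdempotentElem.eq] using
      expect_card_smul_map_single (LinearMap.mulLeftRight ℝ (P, P))
  have hsq (e : E) : Y e * Y e ≤ (L / 2) • Y e := by
    have : Y e * Y e = (N * P e e) • Y e := by
      simp only [hY, smul_mul_smul_comm, conj_single_mul_self_of_isStarProjection hP, smul_smul]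
      ring_nf
    rw [this]
    exact smul_le_smul_of_nonneg_right (hκ e)
      (smul_nonneg (Nat.cast_nonneg _) (conj_single_nonneg_of_isStarProjection hP e))
  have hvar : 𝔼 e, Y e * Y e ≤ L • 1 := by
    calc 𝔼 e, Y e * Y e ≤ 𝔼 e, (L / 2) • Y e := Finset.expect_le_expect fun e _ => hsq e
      _ = (L / 2) • P := by rw [← Finset.smul_expect, hmean]
      _ ≤ (L / 2) • 1 := smul_le_smul_of_nonneg_left hP.le_one (by positivity)
      _ ≤ L • 1 := smul_le_smul_of_nonneg_right (by linarith) zero_le_one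
  have hnorm (e : E) : ‖Y e‖ ≤ L / 2 := by
    rw [norm_smul, hN, Real.norm_natCast]
    exact (mul_le_mul_of_nonneg_left (norm_conj_single_le_of_isStarProjection hP e)
      (Nat.cast_nonneg _)).trans (hκ e)
  have hbern := freq_not_norm_sum_sub_expect_le hsymm hL (t := 1 / 2) (by norm_num) (by norm_num)
    hnorm hvar s
  have hiff (ω : Fin s → E) := norm_map_sampleOp_sub_le_iff hs (LinearMap.mulLeftRight ℝ (P, P)) ω
  simp only [LinearMap.mulLeftRight_apply, mul_one, hP.isIdempotentElem.eq] at hiff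
  simp only [hiff]
  convert hbern using 5
  ring

theorem freq_not_abs_mulVec_sampleOp_sub_apply_le [Nonempty E] (hP : IsStarProjection P) {L : ℝ}
    (hL : 0 < L) (hκ : ∀ e, Fintype.card E * P e e ≤ L / 2) (hs : 0 < s) {v : E → ℝ}
    (hv : ∀ e, |v e| ≤ 1) (f : E) :
    freq Finset.univ (fun ω : Fin s → E => ¬ |(P *ᵥ sampleOp ω *ᵥ v - P *ᵥ v) f| ≤ 1 / 2)
      ≤ 2 * Real.exp (-(s / (16 * L))) := by
  set N : ℝ := (Fintype.card E : ℝ) with hN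
  have hNpos : 0 < N := by rw [hN]; exact_mod_cast Fintype.card_pos
  let φ : Matrix E E ℝ →ₗ[ℝ] ℝ :=
    { toFun A := (P *ᵥ A *ᵥ v) f
      map_add' A B := by simp [Matrix.add_mulVec, Matrix.mulVec_add]
      map_smul' c A := by simp [Matrix.smul_mulVec, Matrix.mulVec_smul] }
  have hφ (e : E) : N • φ (Matrix.single e e 1) = N * P f e * v e := by
    simp [φ, single_one_mulVec, mul_assoc, -Matrix.mulVec_mulVec]
  have habs (e : E) : |N * P f e| ≤ L / 2 := by
    rw [abs_mul, abs_of_pos hNpos, ← le_div_iff₀' hNpos]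
    exact abs_apply_le_of_isStarProjection hP (fun e => (le_div_iff₀' hNpos).2 (hκ e)) f e
  have hvar : 𝔼 e, (N • φ (Matrix.single e e 1)) ^ 2 ≤ L := by
    have hle (e : E) : (N • φ (Matrix.single e e 1)) ^ 2 ≤ N ^ 2 * (P f e * P f e) := by
      rw [hφ, mul_pow, mul_pow, ← sq (P f e)]
      exact mul_le_of_le_one_right (by positivity) ((sq_le_one_iff_abs_le_one _).2 (hv e))
    calc _ ≤ (∑ e, N ^ 2 * (P f e * P f e)) / N := by
          rw [Finset.expect_eq_sum_div_card, Finset.card_univ]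
          gcongr with e
          exact hle e
      _ = N * P f f := by
          rw [← Finset.mul_sum, sum_mul_apply_of_isStarProjection hP]
          field_simp
      _ ≤ L := (hκ f).trans (by linarith)
  have hbern := freq_not_abs_sum_sub_expect_le (f := fun e => N • φ (Matrix.single e e 1)) hL
    (t := 1 / 2) (by norm_num) (by norm_num)
    (fun e => by
      rw [hφ, abs_mul]
      exact (mul_le_of_le_one_right (abs_nonneg _) (hv e)).trans (habs e)) hvar s
  have hiff (ω : Fin s → E) := norm_map_sampleOp_sub_le_iff hs φ ω (1 / 2)
  have hdiff (ω : Fin s → E) :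
      φ (sampleOp ω) - φ 1 = (P *ᵥ sampleOp ω *ᵥ v - P *ᵥ v) f := by
    simp [φ, -Matrix.mulVec_mulVec]
  simp only [Real.norm_eq_abs, hdiff] at hiff
  simp only [hiff]
  convert hbern using 4
  ring

theorem freq_not_norm_mulVec_sampleOp_sub_le [Nonempty E] (hP : IsStarProjection P) {L : ℝ}
    (hL : 0 < L) (hκ : ∀ e, Fintype.card E * P e e ≤ L / 2) (hs : 0 < s) {w : E → ℝ}
    (hw : P *ᵥ w = w) :
    freq Finset.univ (fun ω : Fin s → E => ¬ ‖P *ᵥ sampleOp ω *ᵥ w - w‖ ≤ ‖w‖ / 2)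
      ≤ Fintype.card E * (2 * Real.exp (-(s / (16 * L)))) := by
  obtain ⟨v, hv, hvw⟩ : ∃ v : E → ℝ, (∀ e, |v e| ≤ 1) ∧ ‖w‖ • v = w :=
    exists_abs_le_one_norm_smul_eq w
  have hsub (ω : Fin s → E) : P *ᵥ sampleOp ω *ᵥ w - w
      = ‖w‖ • (P *ᵥ sampleOp ω *ᵥ v - P *ᵥ v) := by
    rw [smul_sub, ← Matrix.mulVec_smul, ← Matrix.mulVec_smul, ← Matrix.mulVec_smul, hvw, hw]
  calc _ ≤ freq Finset.univ fun ω : Fin s → E => ∃ f ∈ Finset.univ,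
          ¬ |(P *ᵥ sampleOp ω *ᵥ v - P *ᵥ v) f| ≤ 1 / 2 := by
        refine freq_mono fun ω _ => ?_
        contrapose!
        intro h
        rw [hsub, norm_smul, norm_norm, div_eq_mul_one_div]
        gcongr
        exact (pi_norm_le_iff_of_nonneg (by norm_num)).2 fun f => h f (Finset.mem_univ f)
    _ ≤ _ := freq_exists_le _ _
    _ ≤ ∑ _f : E, 2 * Real.exp (-(s / (16 * L))) := Finset.sum_le_sum fun f _ =>
        freq_not_abs_mulVec_sampleOp_sub_apply_le hP hL hκ hs hv f
    _ = _ := by rw [Finset.sum_const, nsmul_eq_mul, Finset.card_univ]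

end Sampling

section SamplingMatrix

open scoped BigOperators MatrixOrder Matrix.Norms.L2Operator

variable {α β : Type*}

/-- The inverse of the vectorization `Matrix.vec`, which stacks the columns of a matrix. -/
def unvec : (β × α → ℝ) →ₗ[ℝ] Matrix α β ℝ where
  toFun w := Matrix.of fun a b => w (b, a)
  map_add' _ _ := rfl
  map_smul' _ _ := rfl

theorem vec_unvec (w : β × α → ℝ) : (unvec w).vec = w := rfl

theorem unvec_vec (A : Matrix α β ℝ) : unvec A.vec = A := rfl

theorem unvec_apply (w : β × α → ℝ) (a : α) (b : β) : unvec w a b = w (b, a) := rfl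

variable [Fintype α] [DecidableEq α] [Fintype β] [DecidableEq β] {s : ℕ}

omit [DecidableEq α] in
theorem norm_unvec_le (w : β × α → ℝ) : ‖unvec w‖ ≤ √(w ⬝ᵥ w) := by
  refine (opNorm_le_iff_dotProduct_le (Real.sqrt_nonneg _)).2 fun x y => ?_
  have hx := dotProduct_self_nonneg_real x
  have hy := dotProduct_self_nonneg_real y
  have hbil : x ⬝ᵥ unvec w *ᵥ y = ∑ e, (y e.1 * x e.2) * w e := by
    simp only [dotProduct, Matrix.mulVec, unvec_apply, Fintype.sum_prod_type_right,
      Finset.mul_sum]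
    exact Finset.sum_congr rfl fun a _ => Finset.sum_congr rfl fun b _ => by ring
  have hnorm : ∑ e : β × α, (y e.1 * x e.2) ^ 2 = (x ⬝ᵥ x) * (y ⬝ᵥ y) := by
    simp only [dotProduct, Fintype.sum_prod_type, mul_comm (∑ i, x i * x i), Finset.sum_mul_sum]
    exact Finset.sum_congr rfl fun a _ => Finset.sum_congr rfl fun b _ => by ring
  have hsq : ∑ e, w e ^ 2 = w ⬝ᵥ w := Finset.sum_congr rfl fun e _ => sq _
  rw [hbil]
  refine (Real.sum_mul_le_sqrt_mul_sqrt _ _ _).trans ?_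
  rw [hnorm, hsq, mul_comm]
  gcongr
  refine Real.sqrt_le_iff.2 ⟨by positivity, ?_⟩
  nlinarith [sq_nonneg (x ⬝ᵥ x - y ⬝ᵥ y)]

theorem expect_single_fst_le_smul_one {n m : Type*} [Fintype n] [DecidableEq n] [Nonempty n]
    [Fintype m] [Nonempty m] {g : n × m → ℝ} {c L : ℝ} (hg : ∀ e, g e ≤ c)
    (hc : c ≤ Fintype.card n * L) : 𝔼 e : n × m, Matrix.single e.1 e.1 (g e) ≤ L • 1 := by
  have hn : (0 : ℝ) < Fintype.card n := by exact_mod_cast Fintype.card_pos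
  rw [le_smul_one_iff_dotProduct_le (isSymm_expect fun e => Matrix.transpose_single _ _ _)]
  intro x
  have hquad : x ⬝ᵥ (𝔼 e : n × m, Matrix.single e.1 e.1 (g e)) *ᵥ x
      = 𝔼 e : n × m, g e * x e.1 ^ 2 := by
    simp only [Finset.expect, Matrix.smul_mulVec, Matrix.sum_mulVec, dotProduct_smul,
      dotProduct_sum, Matrix.single_mulVec, ← Pi.single.eq_1, dotProduct_single]
    congr 1
    exact Finset.sum_congr rfl fun e _ => by ring
  calc _ = 𝔼 e : n × m, g e * x e.1 ^ 2 := hquad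
    _ ≤ 𝔼 e : n × m, c * x e.1 ^ 2 :=
        Finset.expect_le_expect fun e _ => mul_le_mul_of_nonneg_right (hg e) (sq_nonneg _)
    _ = 𝔼 a, c * x a ^ 2 := by
        rw [← Finset.univ_product_univ, Finset.expect_product]
        exact Finset.expect_congr rfl fun a _ => Fintype.expect_const (c * x a ^ 2)
    _ = c / Fintype.card n * (x ⬝ᵥ x) := by
        rw [← Finset.mul_expect, Fintype.expect_eq_sum_div_card, dotProduct, mul_div_assoc',
          div_mul_eq_mul_div]
        simp only [sq]
    _ ≤ L * (x ⬝ᵥ x) :=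
        mul_le_mul_of_nonneg_right ((div_le_iff₀' hn).2 hc) (dotProduct_self_nonneg_real x)

theorem expect_single_snd_le_smul_one {n m : Type*} [Fintype n] [Nonempty n] [Fintype m]
    [DecidableEq m] [Nonempty m] {g : n × m → ℝ} {c L : ℝ} (hg : ∀ e, g e ≤ c)
    (hc : c ≤ Fintype.card m * L) : 𝔼 e : n × m, Matrix.single e.2 e.2 (g e) ≤ L • 1 :=
  (Fintype.expect_equiv (Equiv.prodComm n m) _ _ fun _ => rfl).trans_le
    (expect_single_fst_le_smul_one (g := fun e => g e.swap) (fun e => hg e.swap) hc)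

theorem norm_single_le_abs (i : α) (j : β) (x : ℝ) : ‖Matrix.single i j x‖ ≤ |x| := by
  rw [← unvec_vec (Matrix.single _ _ _), Matrix.vec_single]
  refine (norm_unvec_le _).trans_eq ?_
  rw [single_dotProduct, Pi.single_eq_same, ← sq, Real.sqrt_sq_eq_abs]

/-- The linear map that applies an operator on vectorized matrices to `v` and reads the result as a
matrix. Composed with it, sampling is a sum of independent random matrices. -/
def unvecMulVec (v : β × α → ℝ) : Matrix (β × α) (β × α) ℝ →ₗ[ℝ] Matrix α β ℝ where
  toFun A := unvec (A *ᵥ v)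
  map_add' A B := by simp [Matrix.add_mulVec]
  map_smul' c A := by simp [Matrix.smul_mulVec]

theorem smul_unvecMulVec_single (c : ℝ) (v : β × α → ℝ) (e : β × α) :
    c • unvecMulVec v (Matrix.single e e 1) = Matrix.single e.2 e.1 (c * v e) := by
  rw [← Matrix.vec_inj]
  simp [unvecMulVec, single_one_mulVec, Matrix.vec_single, vec_unvec, ← Pi.single_smul]

theorem freq_not_norm_unvec_sampleOp_sub_le_of_abs_le [Nonempty (β × α)] {L b : ℝ} (hL : 0 < L)
    (hLb : Fintype.card (β × α) * b ≤ L / 2)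
    (hα : Fintype.card α * (Fintype.card (β × α) * b ^ 2) ≤ L)
    (hβ : Fintype.card β * (Fintype.card (β × α) * b ^ 2) ≤ L) (hs : 0 < s) {v : β × α → ℝ}
    (hv : ∀ e, |v e| ≤ b) :
    freq Finset.univ (fun ω : Fin s → β × α => ¬ ‖unvec (sampleOp ω *ᵥ v - v)‖ ≤ 1 / 4)
      ≤ 2 * ((Fintype.card α + Fintype.card β) * Real.exp (-(s / (64 * L)))) := by
  have := Nonempty.map Prod.fst ‹Nonempty (β × α)›
  have := Nonempty.map Prod.snd ‹Nonempty (β × α)›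
  set N : ℝ := (Fintype.card (β × α) : ℝ)
  have hφ (e : β × α) := smul_unvecMulVec_single N v e
  have habs (e : β × α) : |N * v e| ≤ N * b := by
    rw [abs_mul, abs_of_nonneg (Nat.cast_nonneg _)]
    exact mul_le_mul_of_nonneg_left (hv e) (Nat.cast_nonneg _)
  have hsq (e : β × α) : N * v e * (N * v e) ≤ (N * b) ^ 2 := by
    rw [← sq]
    exact sq_le_sq' (abs_le.1 (habs e)).1 (abs_le.1 (habs e)).2
  have hsplit : (N * b) ^ 2 = Fintype.card β * Fintype.card α * (N * b ^ 2) := by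
    rw [← Nat.cast_mul, ← Fintype.card_prod]
    ring
  have hleft : (N * b) ^ 2 ≤ Fintype.card α * L := by
    rw [hsplit, mul_comm (Fintype.card β : ℝ), mul_assoc]
    gcongr
  have hright : (N * b) ^ 2 ≤ Fintype.card β * L := by
    rw [hsplit, mul_assoc]
    gcongr
  have hbern := freq_not_norm_sum_sub_expect_le_of_rect
    (B := fun e => N • unvecMulVec v (Matrix.single e e 1)) hL (t := 1 / 4) (by norm_num)
    (by norm_num) (fun e => hφ e ▸ (norm_single_le_abs _ _ _).trans ((habs e).trans hLb))
    (by
      simp only [hφ, Matrix.transpose_single, Matrix.single_mul_single_same]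
      exact expect_single_snd_le_smul_one hsq hleft)
    (by
      simp only [hφ, Matrix.transpose_single, Matrix.single_mul_single_same]
      exact expect_single_fst_le_smul_one hsq hright) s
  refine (freq_mono fun ω _ hω => ?_).trans (hbern.trans_eq ?_)
  · rw [← norm_map_sampleOp_sub_le_iff hs (unvecMulVec v) ω]
    simpa [unvecMulVec] using hω
  · congr 4
    ring

theorem freq_not_norm_unvec_sampleOp_sub_le [Nonempty (β × α)] {L b : ℝ} (hL : 0 < L) (hb : 0 < b)
    (hLb : Fintype.card (β × α) * b ≤ L / 2)
    (hα : Fintype.card α * (Fintype.card (β × α) * b ^ 2) ≤ L)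
    (hβ : Fintype.card β * (Fintype.card (β × α) * b ^ 2) ≤ L) (hs : 0 < s) (w : β × α → ℝ) :
    freq Finset.univ (fun ω : Fin s → β × α => ¬ ‖unvec (sampleOp ω *ᵥ w - w)‖ ≤ ‖w‖ / (4 * b))
      ≤ 2 * ((Fintype.card α + Fintype.card β) * Real.exp (-(s / (64 * L)))) := by
  obtain ⟨v, hv, hvw⟩ := exists_abs_le_one_norm_smul_eq w
  have hbv (e : β × α) : |(b • v) e| ≤ b := by
    rw [Pi.smul_apply, smul_eq_mul, abs_mul, abs_of_pos hb]
    exact mul_le_of_le_one_right hb.le (hv e)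
  have hscale : w = (‖w‖ / b) • b • v := by rw [smul_smul, div_mul_cancel₀ _ hb.ne', hvw]
  refine (freq_mono fun ω _ hω => ?_).trans
    (freq_not_norm_unvec_sampleOp_sub_le_of_abs_le hL hLb hα hβ hs hbv)
  contrapose! hω
  calc ‖unvec (sampleOp ω *ᵥ w - w)‖
      = ‖w‖ / b * ‖unvec (sampleOp ω *ᵥ (b • v) - b • v)‖ := by
        nth_rw 1 2 [hscale]
        rw [Matrix.mulVec_smul, ← smul_sub, map_smul, norm_smul,
          Real.norm_of_nonneg (by positivity)]
    _ ≤ ‖w‖ / b * (1 / 4) := by gcongr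
    _ = ‖w‖ / (4 * b) := by field_simp

end SamplingMatrix

/-! ### Dual certificates by golfing -/

section IteratedSampling

open scoped BigOperators

variable {σ B : Type*} {good : σ → B → Prop} {next : σ → B → σ}

/-- A process with states in `σ` that starts in `w` and is driven by `ω 0, …, ω (q - 1)` satisfies
`good` in each of its `q` steps. -/
def SeqGood (good : σ → B → Prop) (next : σ → B → σ) : (q : ℕ) → σ → (Fin q → B) → Prop
  | 0, _, _ => True
  | q + 1, w, ω => good w (ω 0) ∧ SeqGood good next q (next w (ω 0)) (Fin.tail ω)

theorem freq_univ_cons [Fintype B] {q : ℕ} (p : (Fin (q + 1) → B) → Prop) :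
    freq Finset.univ p = 𝔼 η, freq Finset.univ fun ω : Fin q → B => p (Fin.cons η ω) := by
  classical
  simp only [freq_eq_expect, expect_univ_cons]

theorem freq_not_seqGood_le [Fintype B] [Nonempty B] {I : σ → Prop}
    (hI : ∀ w, I w → ∀ η, I (next w η)) {δ : ℝ}
    (hδ : ∀ w, I w → freq Finset.univ (fun η => ¬ good w η) ≤ δ) (q : ℕ) {w : σ} (hw : I w) :
    freq Finset.univ (fun ω : Fin q → B => ¬ SeqGood good next q w ω) ≤ q * δ := by
  induction q generalizing w with
  | zero => simp [SeqGood, freq]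
  | succ q ih =>
    have hfirst : 𝔼 η, freq Finset.univ (fun _ : Fin q → B => ¬ good w η) ≤ δ := by
      refine le_of_eq_of_le ?_ (hδ w hw)
      classical
      rw [freq_eq_expect]
      refine Finset.expect_congr rfl fun η _ => ?_
      by_cases h : good w η <;> simp [freq, h]
    have hrest : 𝔼 η, freq Finset.univ (fun ω : Fin q → B => ¬ SeqGood good next q (next w η) ω)
        ≤ q * δ :=
      Finset.expect_le Finset.univ_nonempty fun η _ => ih (hI w hw η)
    calc freq Finset.univ (fun ω : Fin (q + 1) → B => ¬ SeqGood good next (q + 1) w ω)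
        = 𝔼 η, freq Finset.univ
            fun ω : Fin q → B => ¬ (good w η ∧ SeqGood good next q (next w η) ω) := by
          rw [freq_univ_cons]
          simp only [SeqGood, Fin.cons_zero, Fin.tail_cons]
      _ ≤ 𝔼 η, (freq Finset.univ (fun _ : Fin q → B => ¬ good w η)
            + freq Finset.univ fun ω : Fin q → B => ¬ SeqGood good next q (next w η) ω) :=
          Finset.expect_le_expect fun η _ =>
            (freq_mono fun ω _ h => not_and_or.1 h).trans freq_or_le
      _ ≤ δ + q * δ := by
          rw [Finset.expect_add_distrib]
          exact add_le_add hfirst hrest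
      _ = (q + 1 : ℕ) * δ := by
          push_cast
          ring

end IteratedSampling

section SampledProjection

open scoped Matrix.Norms.L2Operator

variable {E : Type*} [Fintype E] {s : ℕ}

theorem dotProduct_mulVec_of_isSymm {A : Matrix E E ℝ} (hA : A.IsSymm) (x y : E → ℝ) :
    x ⬝ᵥ A *ᵥ y = (A *ᵥ x) ⬝ᵥ y := by
  rw [Matrix.dotProduct_mulVec, ← Matrix.mulVec_transpose, hA.eq]

theorem sq_dotProduct_le (x y : E → ℝ) : (x ⬝ᵥ y) ^ 2 ≤ (x ⬝ᵥ x) * (y ⬝ᵥ y) := by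
  simpa only [dotProduct, sq] using Finset.sum_mul_sq_le_sq_mul_sq Finset.univ x y

theorem dotProduct_self_le_card_mul_norm_sq (x : E → ℝ) : x ⬝ᵥ x ≤ Fintype.card E * ‖x‖ ^ 2 := by
  calc x ⬝ᵥ x ≤ ∑ _e : E, ‖x‖ ^ 2 := by
        refine Finset.sum_le_sum fun e _ => ?_
        rw [← sq, ← sq_abs]
        gcongr
        exact norm_le_pi_norm x e
    _ = Fintype.card E * ‖x‖ ^ 2 := by
        rw [Finset.sum_const, Finset.card_univ, nsmul_eq_mul]

theorem abs_dotProduct_lt_of_isStarProjection {P : Matrix E E ℝ} (hP : IsStarProjection P)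
    {g Δ : E → ℝ} (hg : P *ᵥ g = g) {ε c f : ℝ} (hf : 0 < f) (hgg : g ⬝ᵥ g ≤ ε)
    (hΔ : (P *ᵥ Δ) ⬝ᵥ (P *ᵥ Δ) ≤ c * f) (hε : 4 * (ε * c) < 1) :
    |g ⬝ᵥ Δ| < √f / 2 := by
  have hgΔ : g ⬝ᵥ Δ = g ⬝ᵥ P *ᵥ Δ := by
    rw [dotProduct_mulVec_of_isSymm (isSymm_of_isStarProjection hP), hg]
  refine abs_lt_of_sq_lt_sq ?_ (by positivity)
  calc (g ⬝ᵥ Δ) ^ 2 ≤ (g ⬝ᵥ g) * ((P *ᵥ Δ) ⬝ᵥ (P *ᵥ Δ)) := hgΔ ▸ sq_dotProduct_le _ _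
    _ ≤ ε * (c * f) :=
        mul_le_mul hgg hΔ (dotProduct_self_nonneg_real _)
          ((dotProduct_self_nonneg_real g).trans hgg)
    _ = 4 * (ε * c) * (f / 4) := by ring
    _ < 1 * (f / 4) := by gcongr
    _ = (√f / 2) ^ 2 := by
        rw [div_pow, Real.sq_sqrt hf.le]
        norm_num

variable [DecidableEq E] {P : Matrix E E ℝ} {ω : Fin s → E}

theorem dotProduct_sampleOp_mulVec_self_le (x : E → ℝ) :
    x ⬝ᵥ sampleOp ω *ᵥ x ≤ Fintype.card E * (x ⬝ᵥ x) := by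
  have hterm (i : Fin s) : x ⬝ᵥ Matrix.single (ω i) (ω i) 1 *ᵥ x ≤ x ⬝ᵥ x := by
    rw [single_one_mulVec, dotProduct_single]
    exact Finset.single_le_sum (f := fun e => x e * x e) (fun _ _ => mul_self_nonneg _)
      (Finset.mem_univ _)
  calc x ⬝ᵥ sampleOp ω *ᵥ x
      = Fintype.card E / s * ∑ i, x ⬝ᵥ Matrix.single (ω i) (ω i) 1 *ᵥ x := by
        rw [sampleOp, Matrix.smul_mulVec, Matrix.sum_mulVec, dotProduct_smul, dotProduct_sum,
          smul_eq_mul]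
    _ ≤ Fintype.card E / s * ∑ _i : Fin s, x ⬝ᵥ x := by
        gcongr with i
        exact hterm i
    _ = (s / s) * (Fintype.card E * (x ⬝ᵥ x)) := by
        rw [Finset.sum_const, Finset.card_univ, Fintype.card_fin, nsmul_eq_mul]
        ring
    _ ≤ Fintype.card E * (x ⬝ᵥ x) :=
        mul_le_of_le_one_left (mul_nonneg (Nat.cast_nonneg _) (dotProduct_self_nonneg_real x))
          (div_self_le_one _)

theorem half_dotProduct_le_dotProduct_sampleOp (hP : IsStarProjection P)
    (h : ‖P * sampleOp ω * P - P‖ ≤ 1 / 2) (x : E → ℝ) :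
    1 / 2 * ((P *ᵥ x) ⬝ᵥ (P *ᵥ x)) ≤ (P *ᵥ x) ⬝ᵥ sampleOp ω *ᵥ P *ᵥ x := by
  have hPP : P *ᵥ P *ᵥ x = P *ᵥ x := by rw [Matrix.mulVec_mulVec, hP.isIdempotentElem.eq]
  have hbound := (opNorm_le_iff_dotProduct_le (by norm_num)).1 h (P *ᵥ x) (-(P *ᵥ x))
  rw [Matrix.mulVec_neg, dotProduct_neg, neg_dotProduct_neg, Matrix.sub_mulVec, dotProduct_sub,
    ← Matrix.mulVec_mulVec, ← Matrix.mulVec_mulVec, hPP,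
    dotProduct_mulVec_of_isSymm (isSymm_of_isStarProjection hP), hPP] at hbound
  linarith

theorem sampleOp_mulVec_eq_zero {x : E → ℝ} (hx : ∀ i, x (ω i) = 0) : sampleOp ω *ᵥ x = 0 := by
  simp [sampleOp, Matrix.smul_mulVec, Matrix.sum_mulVec, single_one_mulVec, hx]

/-- The entries of `P *ᵥ Δ` and `(1 - P) *ᵥ Δ` cancel wherever they are sampled. -/
theorem dotProduct_mulVec_self_le_of_sampleOp_mulVec_eq_zero (hP : IsStarProjection P)
    (h : ‖P * sampleOp ω * P - P‖ ≤ 1 / 2) {Δ : E → ℝ} (hΔ : sampleOp ω *ᵥ Δ = 0) :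
    (P *ᵥ Δ) ⬝ᵥ (P *ᵥ Δ)
      ≤ 2 * Fintype.card E * (((1 - P) *ᵥ Δ) ⬝ᵥ ((1 - P) *ᵥ Δ)) := by
  have hsplit : P *ᵥ Δ = Δ - (1 - P) *ᵥ Δ := by rw [Matrix.sub_mulVec, Matrix.one_mulVec]; abel
  have hcancel : (P *ᵥ Δ) ⬝ᵥ sampleOp ω *ᵥ P *ᵥ Δ
      = ((1 - P) *ᵥ Δ) ⬝ᵥ sampleOp ω *ᵥ (1 - P) *ᵥ Δ := by
    rw [hsplit, Matrix.mulVec_sub, hΔ, zero_sub, dotProduct_neg,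
      dotProduct_mulVec_of_isSymm (sampleOp_isSymm ω), Matrix.mulVec_sub, hΔ, zero_sub,
      neg_dotProduct, neg_neg, ← dotProduct_mulVec_of_isSymm (sampleOp_isSymm ω)]
  have hlower := half_dotProduct_le_dotProduct_sampleOp hP h Δ
  have hupper := dotProduct_sampleOp_mulVec_self_le (ω := ω) ((1 - P) *ᵥ Δ)
  linarith

end SampledProjection

section Golfing

open scoped Matrix.Norms.L2Operator Kronecker

theorem isStarProjection_mul_transpose {α κ : Type*} [Fintype α] [Fintype κ] [DecidableEq κ]
    {U : Matrix α κ ℝ} (hU : Uᵀ * U = 1) : IsStarProjection (U * Uᵀ) where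
  isIdempotentElem := by
    rw [IsIdempotentElem, Matrix.mul_assoc, ← Matrix.mul_assoc Uᵀ, hU, Matrix.one_mul]
  isSelfAdjoint := by simp [IsSelfAdjoint, Matrix.star_eq_conjTranspose]

theorem isStarProjection_kronecker {α β : Type*} [Fintype α] [Fintype β]
    {A : Matrix α α ℝ} {B : Matrix β β ℝ} (hA : IsStarProjection A) (hB : IsStarProjection B) :
    IsStarProjection (A ⊗ₖ B) where
  isIdempotentElem := by
    rw [IsIdempotentElem, ← Matrix.mul_kronecker_mul, hA.isIdempotentElem.eq,
      hB.isIdempotentElem.eq]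
  isSelfAdjoint := by
    rw [IsSelfAdjoint, Matrix.star_eq_conjTranspose, Matrix.conjTranspose_kronecker,
      ← Matrix.star_eq_conjTranspose, ← Matrix.star_eq_conjTranspose, hA.isSelfAdjoint.star_eq,
      hB.isSelfAdjoint.star_eq]

variable {α β : Type} [Fintype α] [DecidableEq α] [Fintype β] [DecidableEq β]

namespace CompactSVD

variable {M : Matrix α β ℝ} (S : CompactSVD M)

/-- The projection `Z ↦ (1 - U Uᵀ) Z (1 - V Vᵀ)`, acting on vectorized matrices. -/
def perpProj : Matrix (β × α) (β × α) ℝ := (1 - S.V * S.Vᵀ) ⊗ₖ (1 - S.U * S.Uᵀ)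

/-- The projection onto the tangent space at `M` of the matrices of the same rank, acting on
vectorized matrices. -/
def tangentProj : Matrix (β × α) (β × α) ℝ := 1 - S.perpProj

theorem one_sub_tangentProj : 1 - S.tangentProj = S.perpProj := sub_sub_cancel _ _

theorem isStarProjection_perpProj : IsStarProjection S.perpProj :=
  isStarProjection_kronecker (isStarProjection_mul_transpose S.V_orth).one_sub
    (isStarProjection_mul_transpose S.U_orth).one_sub

theorem isStarProjection_tangentProj : IsStarProjection S.tangentProj :=
  S.isStarProjection_perpProj.one_sub

theorem tangentProj_mulVec (w : β × α → ℝ) : S.tangentProj *ᵥ w = w - S.perpProj *ᵥ w := by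
  rw [tangentProj, Matrix.sub_mulVec, Matrix.one_mulVec]

theorem perpProj_mulVec_vec (Z : Matrix α β ℝ) :
    S.perpProj *ᵥ Z.vec = ((1 - S.U * S.Uᵀ) * Z * (1 - S.V * S.Vᵀ)).vec := by
  rw [perpProj, Matrix.kronecker_mulVec_vec,
    isSymm_of_isStarProjection (isStarProjection_mul_transpose S.V_orth).one_sub]

theorem perpProj_mulVec_vec_mul (B : Matrix (Fin S.rk) β ℝ) :
    S.perpProj *ᵥ (S.U * B).vec = 0 := by
  rw [perpProj_mulVec_vec, ← Matrix.mul_assoc (1 - S.U * S.Uᵀ), Matrix.sub_mul,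
    Matrix.mul_assoc S.U, S.U_orth, Matrix.one_mul, Matrix.mul_one, sub_self, Matrix.zero_mul,
    Matrix.zero_mul, Matrix.vec_zero]

theorem perpProj_mulVec_vec_self : S.perpProj *ᵥ M.vec = 0 := by
  have hM : M = S.U * (Matrix.diagonal S.s * S.Vᵀ) := S.eq.trans (Matrix.mul_assoc _ _ _)
  exact (congrArg (S.perpProj *ᵥ Matrix.vec ·) hM).trans (S.perpProj_mulVec_vec_mul _)

theorem tangentProj_mulVec_vec_UV :
    S.tangentProj *ᵥ (S.U * S.Vᵀ).vec = (S.U * S.Vᵀ).vec := by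
  rw [tangentProj_mulVec, perpProj_mulVec_vec_mul, sub_zero]

theorem tangentProj_apply_self_le (e : β × α) :
    S.tangentProj e e ≤ (S.V * S.Vᵀ) e.1 e.1 + (S.U * S.Uᵀ) e.2 e.2 := by
  have hV := apply_self_nonneg_of_isStarProjection (isStarProjection_mul_transpose S.V_orth) e.1
  have hU := apply_self_nonneg_of_isStarProjection (isStarProjection_mul_transpose S.U_orth) e.2
  simp only [tangentProj, perpProj, Matrix.sub_apply, Matrix.kroneckerMap_apply,
    Matrix.one_apply_eq]
  linarith [mul_nonneg hV hU]

theorem norm_unvec_perpProj_mulVec_le (w : β × α → ℝ) :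
    ‖unvec (S.perpProj *ᵥ w)‖ ≤ ‖unvec w‖ := by
  have hU := (isStarProjection_mul_transpose S.U_orth).one_sub.norm_le
  have hV := (isStarProjection_mul_transpose S.V_orth).one_sub.norm_le
  rw [← vec_unvec w, perpProj_mulVec_vec, unvec_vec, unvec_vec]
  calc _ ≤ ‖1 - S.U * S.Uᵀ‖ * ‖unvec w‖ * ‖1 - S.V * S.Vᵀ‖ :=
        (Matrix.l2_opNorm_mul _ _).trans (by gcongr; exact Matrix.l2_opNorm_mul _ _)
    _ ≤ 1 * ‖unvec w‖ * 1 := by gcongr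
    _ = ‖unvec w‖ := by ring

end CompactSVD

/-- A batch `ω` of samples acts well on `w`: the sampling operator is nearly the identity on the
range of `P`, and it nearly preserves `w` in the entrywise norm after projection and in the operator
norm. -/
structure GolfGood (P : Matrix (β × α) (β × α) ℝ) (b : ℝ) {s : ℕ} (w : β × α → ℝ)
    (ω : Fin s → β × α) : Prop where
  isometry : ‖P * sampleOp ω * P - P‖ ≤ 1 / 2
  entries : ‖P *ᵥ sampleOp ω *ᵥ w - w‖ ≤ ‖w‖ / 2
  operator : ‖unvec (sampleOp ω *ᵥ w - w)‖ ≤ ‖w‖ / (4 * b)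

theorem SeqGood.isometry_zero {P : Matrix (β × α) (β × α) ℝ} {b : ℝ} {s q : ℕ} {w : β × α → ℝ}
    {next : (β × α → ℝ) → (Fin s → β × α) → β × α → ℝ} {ω : Fin q → Fin s → β × α}
    (h : SeqGood (GolfGood P b) next q w ω) (hq : 0 < q) :
    ‖P * sampleOp (ω ⟨0, hq⟩) * P - P‖ ≤ 1 / 2 := by
  cases q with
  | zero => exact absurd hq (lt_irrefl 0)
  | succ q => exact h.1.isometry

section Residual

variable {E : Type*} [Fintype E] [DecidableEq E] {P : Matrix E E ℝ} {s : ℕ} {ω : Fin s → E}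
  {w : E → ℝ}

/-- The residual after one golfing step. -/
noncomputable def golfNext (P : Matrix E E ℝ) (w : E → ℝ) (ω : Fin s → E) : E → ℝ :=
  w - P *ᵥ sampleOp ω *ᵥ w

theorem mulVec_golfNext (hP : IsStarProjection P) (hw : P *ᵥ w = w) :
    P *ᵥ golfNext P w ω = golfNext P w ω := by
  rw [golfNext, Matrix.mulVec_sub, hw, Matrix.mulVec_mulVec, hP.isIdempotentElem.eq]

theorem dotProduct_golfNext_le (hw : P *ᵥ w = w) (h : ‖P * sampleOp ω * P - P‖ ≤ 1 / 2) :
    golfNext P w ω ⬝ᵥ golfNext P w ω ≤ 1 / 4 * (w ⬝ᵥ w) := by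
  have hnext : golfNext P w ω = -((P * sampleOp ω * P - P) *ᵥ w) := by
    rw [Matrix.sub_mulVec, ← Matrix.mulVec_mulVec, ← Matrix.mulVec_mulVec, hw, neg_sub, golfNext]
  have hhalf : ‖WithLp.toLp 2 ((P * sampleOp ω * P - P) *ᵥ w)‖ ≤ 1 / 2 * ‖WithLp.toLp 2 w‖ :=
    (Matrix.l2_opNorm_mulVec _ (WithLp.toLp 2 w)).trans (by gcongr)
  rw [hnext, neg_dotProduct_neg, ← norm_toLp_sq, ← norm_toLp_sq]
  calc _ ≤ (1 / 2 * ‖WithLp.toLp 2 w‖) ^ 2 := by gcongr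
    _ = 1 / 4 * ‖WithLp.toLp 2 w‖ ^ 2 := by ring

end Residual

namespace CompactSVD

variable {M : Matrix α β ℝ} (S : CompactSVD M)

theorem perpProj_mulVec_eq_zero {w : β × α → ℝ} (hw : S.tangentProj *ᵥ w = w) :
    S.perpProj *ᵥ w = 0 :=
  sub_eq_self.1 ((S.tangentProj_mulVec w).symm.trans hw)

/-- The certificate is the sum of the sampled residuals. -/
theorem exists_certificate {b : ℝ} (hb : 0 < b) {s : ℕ} (q : ℕ) {w : β × α → ℝ}
    (hw : S.tangentProj *ᵥ w = w) {ω : Fin q → Fin s → β × α}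
    (h : SeqGood (GolfGood S.tangentProj b) (golfNext S.tangentProj) q w ω) :
    ∃ y : β × α → ℝ, (∀ e, (∀ j i, ω j i ≠ e) → y e = 0)
      ∧ (w - S.tangentProj *ᵥ y) ⬝ᵥ (w - S.tangentProj *ᵥ y) ≤ (1 / 4) ^ q * (w ⬝ᵥ w)
      ∧ ‖unvec (S.perpProj *ᵥ y)‖ ≤ ‖w‖ / (2 * b) := by
  induction q generalizing w with
  | zero =>
    refine ⟨0, fun _ _ => rfl, by simp, ?_⟩
    rw [Matrix.mulVec_zero, map_zero, norm_zero]
    positivity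
  | succ q ih =>
    obtain ⟨hgood, hrest⟩ := h
    obtain ⟨y, hsupp, htangent, hperp⟩ :=
      ih (mulVec_golfNext S.isStarProjection_tangentProj hw) hrest
    refine ⟨sampleOp (ω 0) *ᵥ w + y, fun e he => ?_, ?_, ?_⟩
    · rw [Pi.add_apply, sampleOp_mulVec_apply_eq_zero (he 0), hsupp e fun j i => he j.succ i,
        add_zero]
    · rw [Matrix.mulVec_add, ← sub_sub]
      calc _ ≤ (1 / 4) ^ q * (golfNext S.tangentProj w (ω 0) ⬝ᵥ golfNext S.tangentProj w (ω 0)) :=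
            htangent
        _ ≤ (1 / 4) ^ q * (1 / 4 * (w ⬝ᵥ w)) := by
            gcongr
            exact dotProduct_golfNext_le hw hgood.isometry
        _ = (1 / 4) ^ (q + 1) * (w ⬝ᵥ w) := by ring
    · have hsplit : S.perpProj *ᵥ (sampleOp (ω 0) *ᵥ w + y)
          = S.perpProj *ᵥ (sampleOp (ω 0) *ᵥ w - w) + S.perpProj *ᵥ y := by
        rw [Matrix.mulVec_add, Matrix.mulVec_sub, S.perpProj_mulVec_eq_zero hw, sub_zero]
      have hhalf : ‖golfNext S.tangentProj w (ω 0)‖ ≤ ‖w‖ / 2 :=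
        (norm_sub_rev _ _).trans_le hgood.entries
      calc _ ≤ ‖unvec (S.perpProj *ᵥ (sampleOp (ω 0) *ᵥ w - w))‖ + ‖unvec (S.perpProj *ᵥ y)‖ := by
            rw [hsplit, map_add]
            exact norm_add_le _ _
        _ ≤ ‖w‖ / (4 * b) + ‖w‖ / 2 / (2 * b) :=
            add_le_add ((S.norm_unvec_perpProj_mulVec_le _).trans hgood.operator)
              (hperp.trans (by gcongr))
        _ = ‖w‖ / (2 * b) := by
            field_simp
            ring

/-- The dual certificate is tested against `U Vᵀ` plus half the normalized perpendicular part of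
`X - M`. -/
theorem nuclearNorm_lt_of_certificate {X : Matrix α β ℝ} {y : β × α → ℝ}
    (hy : y ⬝ᵥ (X.vec - M.vec) = 0) (hperp : ‖unvec (S.perpProj *ᵥ y)‖ ≤ 1 / 2)
    (htangent : |((S.U * S.Vᵀ).vec - S.tangentProj *ᵥ y) ⬝ᵥ (X.vec - M.vec)|
      < √((S.perpProj *ᵥ (X.vec - M.vec)) ⬝ᵥ (S.perpProj *ᵥ (X.vec - M.vec))) / 2) :
    nuclearNorm M < nuclearNorm X := by
  set Δ := X.vec - M.vec with hΔ
  set Q := S.perpProj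
  set f := √((Q *ᵥ Δ) ⬝ᵥ (Q *ᵥ Δ))
  set z := Q *ᵥ (y + (1 / (2 * f)) • Δ) with hz
  have hQsymm (x y : β × α → ℝ) : x ⬝ᵥ Q *ᵥ y = (Q *ᵥ x) ⬝ᵥ y :=
    dotProduct_mulVec_of_isSymm (isSymm_of_isStarProjection S.isStarProjection_perpProj) x y
  have hQQ (x : β × α → ℝ) : Q *ᵥ Q *ᵥ x = Q *ᵥ x := by
    rw [Matrix.mulVec_mulVec, S.isStarProjection_perpProj.isIdempotentElem.eq]
  have hfpos : 0 < f := by linarith [abs_nonneg (((S.U * S.Vᵀ).vec - S.tangentProj *ᵥ y) ⬝ᵥ Δ)]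
  have hQΔ : (Q *ᵥ Δ) ⬝ᵥ Δ = f ^ 2 := by
    rw [Real.sq_sqrt (dotProduct_self_nonneg_real _), hQsymm, hQQ]
  have hznorm : ‖unvec z‖ ≤ 1 := by
    have hΔnorm : ‖unvec (Q *ᵥ Δ)‖ ≤ f := norm_unvec_le _
    rw [hz, Matrix.mulVec_add, Matrix.mulVec_smul, map_add, map_smul]
    calc _ ≤ ‖unvec (Q *ᵥ y)‖ + ‖(1 / (2 * f)) • unvec (Q *ᵥ Δ)‖ := norm_add_le _ _
      _ ≤ 1 / 2 + 1 / (2 * f) * f := by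
          rw [norm_smul, Real.norm_of_nonneg (by positivity)]
          gcongr
      _ = 1 := by
          field_simp
          norm_num
  have hdual : ‖S.U * S.Vᵀ + unvec z‖ ≤ 1 := by
    refine S.norm_UV_add_le hznorm ?_
    rw [← Matrix.vec_inj, ← perpProj_mulVec_vec, vec_unvec, hQQ]
  have hM : ((S.U * S.Vᵀ).vec + z) ⬝ᵥ M.vec = nuclearNorm M := by
    rw [add_dotProduct, Matrix.vec_dotProduct_vec, S.trace_UV, S.sum_s_eq_nuclearNorm, hz,
      ← hQsymm, S.perpProj_mulVec_vec_self, dotProduct_zero, add_zero]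
  have hcert : ((S.U * S.Vᵀ).vec + z) ⬝ᵥ Δ
      = ((S.U * S.Vᵀ).vec - S.tangentProj *ᵥ y) ⬝ᵥ Δ + f / 2 := by
    rw [hz, Matrix.mulVec_add, Matrix.mulVec_smul, tangentProj_mulVec]
    simp only [add_dotProduct, sub_dotProduct, smul_dotProduct, hy, hQΔ, smul_eq_mul]
    field_simp
    ring
  have hX := trace_transpose_mul_le_nuclearNorm (M := X) hdual
  rw [← Matrix.vec_dotProduct_vec, Matrix.vec_add, vec_unvec, ← add_sub_cancel M.vec X.vec, ← hΔ,
    dotProduct_add, hM, hcert] at hX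
  linarith [(abs_lt.1 htangent).1]

theorem perpProj_dotProduct_self_pos {c : ℝ} {Δ : β × α → ℝ} (hΔ : Δ ≠ 0)
    (h : (S.tangentProj *ᵥ Δ) ⬝ᵥ (S.tangentProj *ᵥ Δ)
      ≤ c * ((S.perpProj *ᵥ Δ) ⬝ᵥ (S.perpProj *ᵥ Δ))) :
    0 < (S.perpProj *ᵥ Δ) ⬝ᵥ (S.perpProj *ᵥ Δ) := by
  refine (dotProduct_self_nonneg_real _).lt_of_ne' fun hzero => hΔ ?_
  rw [hzero, mul_zero] at h
  have hP : S.tangentProj *ᵥ Δ = 0 :=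
    dotProduct_self_eq_zero.1 (h.antisymm (dotProduct_self_nonneg_real _))
  rw [S.tangentProj_mulVec, dotProduct_self_eq_zero.1 hzero, sub_zero] at hP
  exact hP

theorem nuclearNorm_lt_of_seqGood {b : ℝ} (hb : 0 < b) {s q : ℕ}
    (hUV : ‖(S.U * S.Vᵀ).vec‖ ≤ b)
    (hq : (1 / 4) ^ q * (Fintype.card (β × α) * b ^ 2) * (8 * Fintype.card (β × α)) < 1)
    (hq0 : 0 < q) {ω : Fin q → Fin s → β × α}
    (h : SeqGood (GolfGood S.tangentProj b) (golfNext S.tangentProj) q (S.U * S.Vᵀ).vec ω)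
    {X : Matrix α β ℝ} (hX : ∀ j i, X.vec (ω j i) = M.vec (ω j i)) (hne : X ≠ M) :
    nuclearNorm M < nuclearNorm X := by
  have hu := S.tangentProj_mulVec_vec_UV
  have hPstar := S.isStarProjection_tangentProj
  obtain ⟨y, hsupp, htangent, hperp⟩ := S.exists_certificate hb q hu h
  have hΔω (j : Fin q) (i : Fin s) : (X.vec - M.vec) (ω j i) = 0 := sub_eq_zero.2 (hX j i)
  have hΔ0 : X.vec - M.vec ≠ 0 := fun hzero => hne (Matrix.vec_inj.1 (sub_eq_zero.1 hzero))
  have hyΔ : y ⬝ᵥ (X.vec - M.vec) = 0 := by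
    refine Finset.sum_eq_zero fun e _ => ?_
    by_cases he : ∃ j i, ω j i = e
    · obtain ⟨j, i, rfl⟩ := he
      rw [hΔω, mul_zero]
    · push Not at he
      rw [hsupp e he, zero_mul]
  have hPΔ := dotProduct_mulVec_self_le_of_sampleOp_mulVec_eq_zero hPstar
    (h.isometry_zero hq0) (sampleOp_mulVec_eq_zero (hΔω ⟨0, hq0⟩))
  rw [S.one_sub_tangentProj] at hPΔ
  have huu : (S.U * S.Vᵀ).vec ⬝ᵥ (S.U * S.Vᵀ).vec ≤ Fintype.card (β × α) * b ^ 2 :=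
    (dotProduct_self_le_card_mul_norm_sq _).trans (by gcongr)
  refine S.nuclearNorm_lt_of_certificate hyΔ (hperp.trans ?_)
    (abs_dotProduct_lt_of_isStarProjection hPstar
      (ε := (1 / 4) ^ q * (Fintype.card (β × α) * b ^ 2)) ?_
      (S.perpProj_dotProduct_self_pos hΔ0 hPΔ) (htangent.trans (by gcongr)) hPΔ ?_)
  · rw [div_le_div_iff₀ (by positivity) two_pos]
    linarith
  · rw [Matrix.mulVec_sub, Matrix.mulVec_mulVec, hPstar.isIdempotentElem.eq, hu]
  · linarith

end CompactSVD

end Golfing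

/-! ### Sampling with and without replacement -/

section Replacement

open scoped BigOperators

variable {E : Type*}

theorem exists_perm_map_eq [Finite E] {J K : Finset E} (h : J.card = K.card) :
    ∃ π : Equiv.Perm E, J.map π.toEmbedding = K := by
  have e : J ≃ K := Finset.equivOfCardEq h
  obtain ⟨π, hπ⟩ := Equiv.Perm.exists_extending_pair (fun x : J => (x : E)) (fun x => (e x : E))
    Subtype.val_injective (Subtype.val_injective.comp e.injective)
  refine ⟨π, Finset.eq_of_subset_of_card_le (fun x hx => ?_) (by rw [Finset.card_map, h])⟩
  obtain ⟨y, hy, rfl⟩ := Finset.mem_map.1 hx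
  exact (hπ ⟨y, hy⟩).symm ▸ (e ⟨y, hy⟩).2

variable [Fintype E] [DecidableEq E]

theorem expect_perm_map (f : Finset E → ℝ) (J : Finset E) :
    𝔼 π : Equiv.Perm E, f (J.map π.toEmbedding)
      = 𝔼 K ∈ Finset.univ.powersetCard J.card, f K := by
  have hset (π : Equiv.Perm E) :
      𝔼 K ∈ Finset.univ.powersetCard J.card, f (K.map π.toEmbedding)
        = 𝔼 K ∈ Finset.univ.powersetCard J.card, f K :=
    Finset.expect_equiv π.finsetCongr (by simp) fun _ _ => rfl
  have hperm (K : Finset E) (hK : K ∈ Finset.univ.powersetCard J.card) :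
      𝔼 π : Equiv.Perm E, f (K.map π.toEmbedding)
        = 𝔼 π : Equiv.Perm E, f (J.map π.toEmbedding) := by
    obtain ⟨τ, rfl⟩ := exists_perm_map_eq (Finset.mem_powersetCard_univ.1 hK).symm
    refine Fintype.expect_equiv (Equiv.mulRight τ) _ _ fun π => ?_
    rw [Finset.map_map]
    rfl
  rw [← Finset.expect_const (s := (Finset.univ : Finset (Equiv.Perm E))) Finset.univ_nonempty
      (𝔼 K ∈ _, f K), ← Finset.expect_congr rfl fun π _ => hset π, Finset.expect_comm,
    Finset.expect_congr rfl hperm,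
    Finset.expect_const ⟨J, Finset.mem_powersetCard_univ.2 rfl⟩]

/-- Extend the set of values of `ω` to an `m`-subset and apply a uniform permutation to both. -/
theorem freq_powersetCard_le_freq_image {ι : Type*} [Fintype ι] [DecidableEq ι]
    [Nonempty (ι → E)]
    {p : Finset E → Prop} (hp : Antitone p) {m : ℕ} (hι : Fintype.card ι ≤ m)
    (hm : m ≤ Fintype.card E) :
    freq (Finset.univ.powersetCard m) p
      ≤ freq Finset.univ fun ω : ι → E => p (Finset.univ.image ω) := by
  classical
  have hJ (ω : ι → E) : ∃ J : Finset E, Finset.univ.image ω ⊆ J ∧ J.card = m :=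
    Finset.exists_superset_card_eq (Finset.card_image_le.trans hι) hm
  choose J hsub hcard using hJ
  set f : Finset E → ℝ := fun A => if p A then 1 else 0
  have hf : Antitone f := fun A B hAB => by
    by_cases hB : p B
    · simp [f, hB, hp hAB hB]
    · simp only [f, if_neg hB]
      split_ifs <;> norm_num
  have hperm (π : Equiv.Perm E) : 𝔼 ω : ι → E, f ((Finset.univ.image ω).map π.toEmbedding)
      = 𝔼 ω : ι → E, f (Finset.univ.image ω) := by
    refine Fintype.expect_equiv ((Equiv.refl ι).arrowCongr π) _ _ fun ω => ?_
    rw [Finset.map_eq_image, Finset.image_image]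
    rfl
  rw [freq_eq_expect, freq_eq_expect]
  calc 𝔼 K ∈ Finset.univ.powersetCard m, f K
      = 𝔼 ω : ι → E, 𝔼 π : Equiv.Perm E, f ((J ω).map π.toEmbedding) := by
        simp only [expect_perm_map, hcard, Finset.expect_const Finset.univ_nonempty]
    _ ≤ 𝔼 ω : ι → E, 𝔼 π : Equiv.Perm E, f ((Finset.univ.image ω).map π.toEmbedding) :=
        Finset.expect_le_expect fun ω _ => Finset.expect_le_expect fun π _ =>
          hf (Finset.map_subset_map.2 (hsub ω))
    _ = 𝔼 ω : ι → E, f (Finset.univ.image ω) := by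
        rw [Finset.expect_comm, Finset.expect_congr rfl fun π _ => hperm π,
          Finset.expect_const Finset.univ_nonempty]

end Replacement

/-! ### Exact matrix completion -/

section MatrixCompletion

open scoped Matrix.Norms.L2Operator

variable {α β : Type} [Fintype α] [DecidableEq α] [Fintype β] [DecidableEq β]

/-- `M` is the unique minimizer of the nuclear norm among the matrices with the same entries on `Ω`.
Entries are indexed as in `Matrix.vec`, by the column first. -/
def IsUniqueCompletion (M : Matrix α β ℝ) (Ω : Finset (β × α)) : Prop :=
  ∀ X : Matrix α β ℝ, (∀ e ∈ Ω, X.vec e = M.vec e) → X ≠ M → nuclearNorm M < nuclearNorm X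

theorem isUniqueCompletion_monotone (M : Matrix α β ℝ) : Monotone (IsUniqueCompletion M) :=
  fun _ _ hΩ hM X hX => hM X fun e he => hX e (hΩ he)

namespace CompactSVD

variable {M : Matrix α β ℝ} (S : CompactSVD M) {ρ : ℝ}

theorem incoherence_nonneg : 0 ≤ S.incoherence ρ :=
  le_max_of_le_right (Real.iSup_nonneg fun _ => by positivity)

theorem abs_left_apply_self_sub_le (hρ : 0 < ρ) (p : α) :
    |(S.U * S.Uᵀ) p p - ρ / Fintype.card α| ≤ S.incoherence ρ * √ρ / Fintype.card α := by
  have : Nonempty α := ⟨p⟩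
  have hparam : |(S.U * S.Uᵀ) p p - ρ / Fintype.card α| * Fintype.card α / √ρ
      ≤ S.leftParam ρ := by
    have hle := le_ciSup (f := fun p : α × α => |(S.U * S.Uᵀ) p.1 p.2
      - (if p.1 = p.2 then ρ / Fintype.card α else 0)| * Fintype.card α / √ρ)
      (Set.finite_range _).bddAbove (p, p)
    rwa [if_pos rfl] at hle
  have hmax := hparam.trans
    ((le_max_left _ (S.rightParam ρ)).trans (le_max_left _ (S.crossParam ρ)))
  rwa [div_le_iff₀ (Real.sqrt_pos.2 hρ), ← le_div_iff₀ (by positivity)] at hmax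

theorem abs_right_apply_self_sub_le (hρ : 0 < ρ) (p : β) :
    |(S.V * S.Vᵀ) p p - ρ / Fintype.card β| ≤ S.incoherence ρ * √ρ / Fintype.card β := by
  have : Nonempty β := ⟨p⟩
  have hparam : |(S.V * S.Vᵀ) p p - ρ / Fintype.card β| * Fintype.card β / √ρ
      ≤ S.rightParam ρ := by
    have hle := le_ciSup (f := fun p : β × β => |(S.V * S.Vᵀ) p.1 p.2
      - (if p.1 = p.2 then ρ / Fintype.card β else 0)| * Fintype.card β / √ρ)
      (Set.finite_range _).bddAbove (p, p)
    rwa [if_pos rfl] at hle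
  have hmax := hparam.trans
    ((le_max_right (S.leftParam ρ) _).trans (le_max_left _ (S.crossParam ρ)))
  rwa [div_le_iff₀ (Real.sqrt_pos.2 hρ), ← le_div_iff₀ (by positivity)] at hmax

theorem norm_vec_UV_le (hρ : 0 < ρ) :
    ‖(S.U * S.Vᵀ).vec‖ ≤ S.incoherence ρ * √ρ / √(Fintype.card (β × α)) := by
  have := S.incoherence_nonneg (ρ := ρ)
  refine (pi_norm_le_iff_of_nonneg (by positivity)).2 fun e => ?_
  have : Nonempty β := ⟨e.1⟩
  have : Nonempty α := ⟨e.2⟩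
  have hparam : |(S.U * S.Vᵀ) e.2 e.1| * √(Fintype.card α * Fintype.card β : ℝ) / √ρ
      ≤ S.incoherence ρ :=
    (le_ciSup (f := fun p : α × β => |(S.U * S.Vᵀ) p.1 p.2|
      * √(Fintype.card α * Fintype.card β : ℝ) / √ρ) (Set.finite_range _).bddAbove
      (e.2, e.1)).trans (le_max_right _ _)
  rw [Fintype.card_prod, Nat.cast_mul, mul_comm (Fintype.card β : ℝ)]
  rwa [div_le_iff₀ (Real.sqrt_pos.2 hρ), ← le_div_iff₀ (by positivity)] at hparam

theorem card_mul_sq_eq [Nonempty (β × α)] (hρ : 0 ≤ ρ) :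
    Fintype.card (β × α) * (S.incoherence ρ * √ρ / √(Fintype.card (β × α))) ^ 2
      = S.incoherence ρ ^ 2 * ρ := by
  rw [div_pow, mul_pow, Real.sq_sqrt hρ, Real.sq_sqrt (Nat.cast_nonneg _)]
  field_simp

theorem abs_rk_sub_le [Nonempty α] (hρ : 0 < ρ) : |(S.rk : ℝ) - ρ| ≤ S.incoherence ρ * √ρ := by
  have htrace : (S.rk : ℝ) - ρ = ∑ p, ((S.U * S.Uᵀ) p p - ρ / Fintype.card α) := by
    rw [Finset.sum_sub_distrib, Finset.sum_const, Finset.card_univ, nsmul_eq_mul,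
      mul_div_cancel₀ _ (by positivity)]
    congr 1
    change _ = (S.U * S.Uᵀ).trace
    rw [Matrix.trace_mul_comm, S.U_orth, Matrix.trace_one, Fintype.card_fin]
  calc |(S.rk : ℝ) - ρ| ≤ ∑ p, |(S.U * S.Uᵀ) p p - ρ / Fintype.card α| :=
        htrace ▸ Finset.abs_sum_le_sum_abs _ _
    _ ≤ ∑ _p : α, S.incoherence ρ * √ρ / Fintype.card α :=
        Finset.sum_le_sum fun p _ => S.abs_left_apply_self_sub_le hρ p
    _ = S.incoherence ρ * √ρ := by
        rw [Finset.sum_const, Finset.card_univ, nsmul_eq_mul, mul_div_cancel₀ _ (by positivity)]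

theorem rk_le_sq_incoherence_mul [Nonempty (β × α)] (hρ : 0 < ρ) :
    S.rk ≤ S.incoherence ρ ^ 2 * ρ := by
  calc (S.rk : ℝ) = (S.U * S.Vᵀ).vec ⬝ᵥ (S.U * S.Vᵀ).vec := by
        rw [Matrix.vec_dotProduct_vec, Matrix.transpose_mul, Matrix.transpose_transpose,
          Matrix.mul_assoc, ← Matrix.mul_assoc S.Uᵀ, S.U_orth, Matrix.one_mul,
          Matrix.trace_mul_comm, S.V_orth, Matrix.trace_one, Fintype.card_fin]
    _ ≤ Fintype.card (β × α) * ‖(S.U * S.Vᵀ).vec‖ ^ 2 := dotProduct_self_le_card_mul_norm_sq _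
    _ ≤ _ := by
        rw [← S.card_mul_sq_eq hρ.le]
        gcongr
        exact S.norm_vec_UV_le hρ

/-- If the parameter is small, `abs_rk_sub_le` makes the rank comparable to `ρ` and
`rk_le_sq_incoherence_mul` makes it much smaller. -/
theorem half_le_incoherence [Nonempty (β × α)] (hρ : 1 ≤ ρ) : 1 / 2 ≤ S.incoherence ρ := by
  have := Nonempty.map Prod.snd ‹Nonempty (β × α)›
  have hρ0 : 0 < ρ := by linarith
  have hμ0 := S.incoherence_nonneg (ρ := ρ)
  by_contra! hlt
  have hclose := (abs_le.1 (S.abs_rk_sub_le hρ0)).1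
  have hsqrt : S.incoherence ρ * √ρ ≤ 1 / 2 * ρ :=
    mul_le_mul hlt.le (Real.sqrt_le_iff.2 ⟨hρ0.le, by nlinarith⟩) (Real.sqrt_nonneg _)
      (by norm_num)
  have hsmall : S.incoherence ρ ^ 2 * ρ ≤ 1 / 4 * ρ :=
    mul_le_mul_of_nonneg_right (by nlinarith) hρ0.le
  linarith [S.rk_le_sq_incoherence_mul hρ0]

theorem incoherence_mul_sqrt_le [Nonempty (β × α)] (hρ : 1 ≤ ρ) :
    S.incoherence ρ * √ρ ≤ 2 * (S.incoherence ρ ^ 2 * ρ) := by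
  have hμ := S.half_le_incoherence hρ
  calc S.incoherence ρ * √ρ ≤ (2 * S.incoherence ρ ^ 2) * ρ :=
        mul_le_mul (by nlinarith) (Real.sqrt_le_iff.2 ⟨by linarith, by nlinarith⟩)
          (Real.sqrt_nonneg _) (by positivity)
    _ = 2 * (S.incoherence ρ ^ 2 * ρ) := by ring

theorem quarter_mul_le_sq_incoherence_mul [Nonempty (β × α)] (hρ : 1 ≤ ρ) :
    1 / 4 * ρ ≤ S.incoherence ρ ^ 2 * ρ := by
  have hμ := S.half_le_incoherence hρ
  exact mul_le_mul_of_nonneg_right (by nlinarith) (by linarith)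

theorem card_mul_tangentProj_apply_self_le (hρ : 1 ≤ ρ) {n : ℝ} (hα : Fintype.card α ≤ n)
    (hβ : Fintype.card β ≤ n) (e : β × α) :
    Fintype.card (β × α) * S.tangentProj e e ≤ 12 * (S.incoherence ρ ^ 2 * ρ * n) := by
  have : Nonempty (β × α) := ⟨e⟩
  have : Nonempty β := ⟨e.1⟩
  have : Nonempty α := ⟨e.2⟩
  have hρ0 : 0 < ρ := by linarith
  set μ := S.incoherence ρ
  have hμ0 : 0 ≤ μ := S.incoherence_nonneg
  have hU : (S.U * S.Uᵀ) e.2 e.2 ≤ (ρ + μ * √ρ) / Fintype.card α := by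
    rw [add_div]
    linarith [(abs_le.1 (S.abs_left_apply_self_sub_le hρ0 e.2)).2]
  have hV : (S.V * S.Vᵀ) e.1 e.1 ≤ (ρ + μ * √ρ) / Fintype.card β := by
    rw [add_div]
    linarith [(abs_le.1 (S.abs_right_apply_self_sub_le hρ0 e.1)).2]
  have hsix : ρ + μ * √ρ ≤ 6 * (μ ^ 2 * ρ) := by
    linarith [S.incoherence_mul_sqrt_le hρ, S.quarter_mul_le_sq_incoherence_mul hρ]
  calc Fintype.card (β × α) * S.tangentProj e e
      ≤ Fintype.card (β × α)
          * ((ρ + μ * √ρ) / Fintype.card β + (ρ + μ * √ρ) / Fintype.card α) := by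
        gcongr
        exact (S.tangentProj_apply_self_le e).trans (add_le_add hV hU)
    _ = (ρ + μ * √ρ) * (Fintype.card α + Fintype.card β) := by
        rw [Fintype.card_prod, Nat.cast_mul]
        field_simp
    _ ≤ 6 * (μ ^ 2 * ρ) * (n + n) := by gcongr
    _ = 12 * (μ ^ 2 * ρ * n) := by ring

end CompactSVD

theorem freq_not_golfGood_le [Nonempty (β × α)] {P : Matrix (β × α) (β × α) ℝ}
    (hP : IsStarProjection P) {L b : ℝ} (hL : 0 < L) (hb : 0 < b)
    (hκ : ∀ e, Fintype.card (β × α) * P e e ≤ L / 2) (hLb : Fintype.card (β × α) * b ≤ L / 2)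
    (hα : Fintype.card α * (Fintype.card (β × α) * b ^ 2) ≤ L)
    (hβ : Fintype.card β * (Fintype.card (β × α) * b ^ 2) ≤ L) {s : ℕ} (hs : 0 < s)
    {w : β × α → ℝ} (hw : P *ᵥ w = w) :
    freq Finset.univ (fun ω : Fin s → β × α => ¬ GolfGood P b w ω)
      ≤ (4 * Fintype.card (β × α) + 2 * (Fintype.card α + Fintype.card β))
          * Real.exp (-(s / (64 * L))) := by
  have hexp : Real.exp (-((s : ℝ) / (16 * L))) ≤ Real.exp (-(s / (64 * L))) := by
    gcongr
    norm_num
  have hN := mul_le_mul_of_nonneg_left hexp (Nat.cast_nonneg (Fintype.card (β × α)) : (0 : ℝ) ≤ _)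
  calc freq Finset.univ (fun ω : Fin s → β × α => ¬ GolfGood P b w ω)
      ≤ freq Finset.univ fun ω : Fin s → β × α => (¬ ‖P * sampleOp ω * P - P‖ ≤ 1 / 2
          ∨ ¬ ‖P *ᵥ sampleOp ω *ᵥ w - w‖ ≤ ‖w‖ / 2)
          ∨ ¬ ‖unvec (sampleOp ω *ᵥ w - w)‖ ≤ ‖w‖ / (4 * b) := by
        refine freq_mono fun ω _ hω => ?_
        by_contra! h
        exact hω ⟨h.1.1, h.1.2, h.2⟩
    _ ≤ 2 * (Fintype.card (β × α) * Real.exp (-(s / (16 * L))))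
          + Fintype.card (β × α) * (2 * Real.exp (-(s / (16 * L))))
          + 2 * ((Fintype.card α + Fintype.card β) * Real.exp (-(s / (64 * L)))) :=
        freq_or_le.trans <| add_le_add
          (freq_or_le.trans (add_le_add (freq_not_norm_mul_sampleOp_mul_sub_le hP hL hκ hs)
            (freq_not_norm_mulVec_sampleOp_sub_le hP hL hκ hs hw)))
          (freq_not_norm_unvec_sampleOp_sub_le hL hb hLb hα hβ hs w)
    _ ≤ _ := by linarith

theorem CompactSVD.freq_not_isUniqueCompletion_le_mul_exp [Nonempty (β × α)] {M : Matrix α β ℝ}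
    (S : CompactSVD M) {L b : ℝ} (hL : 0 < L) (hb : 0 < b)
    (hκ : ∀ e, Fintype.card (β × α) * S.tangentProj e e ≤ L / 2)
    (hLb : Fintype.card (β × α) * b ≤ L / 2)
    (hα : Fintype.card α * (Fintype.card (β × α) * b ^ 2) ≤ L)
    (hβ : Fintype.card β * (Fintype.card (β × α) * b ^ 2) ≤ L)
    (hUV : ‖(S.U * S.Vᵀ).vec‖ ≤ b) {s q m : ℕ} (hs : 0 < s) (hq0 : 0 < q)
    (hq : (1 / 4) ^ q * (Fintype.card (β × α) * b ^ 2) * (8 * Fintype.card (β × α)) < 1)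
    (hqs : q * s ≤ m) (hm : m ≤ Fintype.card (β × α)) :
    freq (Finset.univ.powersetCard m) (fun Ω => ¬ IsUniqueCompletion M Ω)
      ≤ q * ((4 * Fintype.card (β × α) + 2 * (Fintype.card α + Fintype.card β))
          * Real.exp (-(s / (64 * L)))) := by
  calc freq (Finset.univ.powersetCard m) (fun Ω => ¬ IsUniqueCompletion M Ω)
      ≤ freq Finset.univ fun ω : Fin q × Fin s → β × α =>
          ¬ IsUniqueCompletion M (Finset.univ.image ω) :=
        freq_powersetCard_le_freq_image
          (fun _ _ hΩ => mt (isUniqueCompletion_monotone M hΩ)) (by simpa using hqs) hm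
    _ = freq Finset.univ fun ω : Fin q → Fin s → β × α =>
          ¬ IsUniqueCompletion M (Finset.univ.image (Function.uncurry ω)) := by
        classical
        simp only [freq_eq_expect]
        exact Fintype.expect_equiv (Equiv.curry _ _ _) _ _ fun _ => rfl
    _ ≤ freq Finset.univ fun ω : Fin q → Fin s → β × α => ¬ SeqGood (GolfGood S.tangentProj b)
          (golfNext S.tangentProj) q (S.U * S.Vᵀ).vec ω := by
        refine freq_mono fun ω _ hω hgood => hω fun X hX hne => ?_
        exact S.nuclearNorm_lt_of_seqGood hb hUV hq hq0 hgood
          (fun j i => hX _ (Finset.mem_image_of_mem _ (Finset.mem_univ (j, i)))) hne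
    _ ≤ _ :=
        freq_not_seqGood_le (I := fun w => S.tangentProj *ᵥ w = w)
          (fun w hw η => mulVec_golfNext S.isStarProjection_tangentProj hw)
          (fun w hw => freq_not_golfGood_le S.isStarProjection_tangentProj hL hb hκ hLb hα hβ hs hw)
          q S.tangentProj_mulVec_vec_UV

theorem le_log_of_two_le {n : ℕ} (hn : 2 ≤ n) : 0.69 ≤ Real.log n := by
  have := Real.log_le_log two_pos (Nat.ofNat_le_cast.2 hn)
  linarith [Real.log_two_gt_d9]

theorem exists_golfing_parameters {n : ℕ} (hn : 2 ≤ n) {K : ℝ} (hK : 1 / 2 ≤ K) :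
    ∃ s q : ℕ, 0 < s ∧ 0 < q ∧ 21504 * (K * Real.log n) ≤ s ∧ 6 * Real.log n ≤ q ∧ q ≤ 8 * n
      ∧ (q : ℝ) * s ≤ 1000000 * (K * Real.log n ^ 6) := by
  have hlog := le_log_of_two_le hn
  have hlogn : Real.log n ≤ n := (Real.log_le_sub_one_of_pos (by positivity)).trans (by linarith)
  set ℓ := Real.log n
  have hKℓ : 1 / 2 * 0.69 ≤ K * ℓ := mul_le_mul hK hlog (by norm_num) (by linarith)
  have hq : (⌈6 * ℓ⌉₊ : ℝ) ≤ 8 * ℓ := by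
    linarith [Nat.ceil_lt_add_one (a := 6 * ℓ) (by linarith)]
  have hs : (⌈21504 * (K * ℓ)⌉₊ : ℝ) ≤ 21508 * (K * ℓ) := by
    linarith [Nat.ceil_lt_add_one (a := 21504 * (K * ℓ)) (by linarith)]
  have hpow : (0.2 : ℝ) ≤ ℓ ^ 4 :=
    (by norm_num : (0.2 : ℝ) ≤ 0.69 ^ 4).trans (by gcongr)
  refine ⟨⌈21504 * (K * ℓ)⌉₊, ⌈6 * ℓ⌉₊, Nat.ceil_pos.2 (by linarith), Nat.ceil_pos.2 (by linarith),
    Nat.le_ceil _, Nat.le_ceil _, ?_, ?_⟩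
  · exact_mod_cast (hq.trans (by linarith) : (⌈6 * ℓ⌉₊ : ℝ) ≤ 8 * n)
  calc (⌈6 * ℓ⌉₊ : ℝ) * ⌈21504 * (K * ℓ)⌉₊ ≤ (8 * ℓ) * (21508 * (K * ℓ)) := by gcongr
    _ = 172064 * (K * ℓ ^ 2) := by ring
    _ ≤ 200000 * (K * ℓ ^ 2) := by gcongr; norm_num
    _ = 1000000 * (K * (0.2 * ℓ ^ 2)) := by ring
    _ ≤ 1000000 * (K * (ℓ ^ 4 * ℓ ^ 2)) := by gcongr
    _ = 1000000 * (K * ℓ ^ 6) := by ring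

theorem quarter_pow_lt_inv_pow {n k q : ℕ} (hn : 0 < n) (hq0 : 0 < q)
    (hq : k * Real.log n ≤ q) : (1 / 4 : ℝ) ^ q < ((n : ℝ) ^ k)⁻¹ := by
  rw [one_div, inv_pow]
  refine inv_strictAnti₀ (by positivity) ?_
  calc (n : ℝ) ^ k = Real.exp (k * Real.log n) := by
        rw [Real.exp_nat_mul, Real.exp_log (by positivity)]
    _ ≤ Real.exp (q * 1) := Real.exp_le_exp.2 (by linarith)
    _ = Real.exp 1 ^ q := Real.exp_nat_mul _ _
    _ < 4 ^ q :=
        pow_lt_pow_left₀ (by linarith [Real.exp_one_lt_d9]) (Real.exp_pos _).le hq0.ne'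

theorem quarter_pow_mul_mul_lt_one {n q : ℕ} (hn : 2 ≤ n) (hq0 : 0 < q)
    (hq : 6 * Real.log n ≤ q) {x N : ℝ} (hx0 : 0 ≤ x) (hx : x ≤ n) (hN : N ≤ (n : ℝ) ^ 2) :
    (1 / 4) ^ q * x * (8 * N) < 1 := by
  have hn' : (2 : ℝ) ≤ n := Nat.ofNat_le_cast.2 hn
  have h8 : (8 : ℝ) ≤ (n : ℝ) ^ 3 := (by norm_num : (8 : ℝ) = 2 ^ 3).trans_le (by gcongr)
  calc (1 / 4 : ℝ) ^ q * x * (8 * N) ≤ (1 / 4 : ℝ) ^ q * x * (8 * n ^ 2) := by gcongr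
    _ ≤ (1 / 4 : ℝ) ^ q * n * (n ^ 3 * n ^ 2) := by gcongr
    _ < ((n : ℝ) ^ 6)⁻¹ * n * (n ^ 3 * n ^ 2) := by
        gcongr
        exact quarter_pow_lt_inv_pow (by omega) hq0 (mod_cast hq)
    _ = 1 := by field_simp

theorem mul_mul_exp_neg_div_le_inv_pow {n s q : ℕ} (hn : 2 ≤ n) {K A : ℝ} (hK : 0 < K)
    (hs : 21504 * (K * Real.log n) ≤ s) (hq : q ≤ 8 * n) (hA0 : 0 ≤ A) (hA : A ≤ 8 * (n : ℝ) ^ 2) :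
    q * (A * Real.exp (-(s / (64 * (24 * K))))) ≤ ((n : ℝ) ^ 5)⁻¹ := by
  have hn' : (2 : ℝ) ≤ n := Nat.ofNat_le_cast.2 hn
  have hn0 : 0 < (n : ℝ) := by linarith
  have hq' : (q : ℝ) ≤ 8 * n := mod_cast hq
  have hexp : Real.exp (-(s / (64 * (24 * K)))) ≤ ((n : ℝ) ^ 14)⁻¹ := by
    rw [← Real.exp_log (pow_pos hn0 14), Real.log_pow, ← Real.exp_neg]
    refine Real.exp_le_exp.2 (neg_le_neg ?_)
    rw [le_div_iff₀ (by positivity)]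
    push_cast
    linarith
  calc q * (A * Real.exp (-(s / (64 * (24 * K)))))
      ≤ 8 * n * (8 * (n : ℝ) ^ 2 * ((n : ℝ) ^ 14)⁻¹) := by gcongr
    _ = 2 ^ 6 * ((n : ℝ) ^ 11)⁻¹ := by
        field_simp
        norm_num
    _ ≤ (n : ℝ) ^ 6 * ((n : ℝ) ^ 11)⁻¹ := by gcongr
    _ = ((n : ℝ) ^ 5)⁻¹ := by field_simp

theorem le_of_mul_log_pow_le_sq {n : ℕ} (hn : 2 ≤ n) {x : ℝ} (hx : 0 ≤ x)
    (h : 1000000 * (x * n * Real.log n ^ 6) ≤ (n : ℝ) ^ 2) : x ≤ n := by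
  have hpow : (0.69 : ℝ) ^ 6 ≤ Real.log n ^ 6 := by
    gcongr
    exact le_log_of_two_le hn
  refine le_of_mul_le_mul_right (a := (n : ℝ)) ?_ (by positivity)
  calc x * n ≤ 1000000 * (x * n * 0.69 ^ 6) := by
        have : 0 ≤ x * n := by positivity
        linarith
    _ ≤ 1000000 * (x * n * Real.log n ^ 6) := by gcongr
    _ ≤ n * n := h.trans_eq (sq _)

theorem CompactSVD.card_mul_div_sqrt_le [Nonempty (β × α)] {M : Matrix α β ℝ} (S : CompactSVD M)
    {ρ : ℝ} (hρ : 1 ≤ ρ) {n : ℝ} (hn : 0 ≤ n) (hN : Fintype.card (β × α) ≤ n ^ 2) :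
    Fintype.card (β × α) * (S.incoherence ρ * √ρ / √(Fintype.card (β × α)))
      ≤ 2 * (S.incoherence ρ ^ 2 * ρ * n) := by
  calc Fintype.card (β × α) * (S.incoherence ρ * √ρ / √(Fintype.card (β × α)))
      = √(Fintype.card (β × α)) * (S.incoherence ρ * √ρ) := by
        rw [mul_div_left_comm, Real.div_sqrt, mul_comm]
    _ ≤ n * (2 * (S.incoherence ρ ^ 2 * ρ)) :=
        mul_le_mul (Real.sqrt_le_iff.2 ⟨hn, hN⟩) (S.incoherence_mul_sqrt_le hρ)
          (mul_nonneg S.incoherence_nonneg (Real.sqrt_nonneg _)) hn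
    _ = 2 * (S.incoherence ρ ^ 2 * ρ * n) := by ring

theorem CompactSVD.freq_not_isUniqueCompletion_le [Nonempty (β × α)] {M : Matrix α β ℝ}
    (S : CompactSVD M) {ρ : ℝ} (hρ : 1 ≤ ρ) {n m : ℕ} (hn : 2 ≤ n) (hα : Fintype.card α ≤ n)
    (hβ : Fintype.card β ≤ n) (hmN : m ≤ Fintype.card (β × α))
    (hm : 1000000 * (S.incoherence ρ ^ 2 * n * ρ * Real.log n ^ 6) ≤ m) :
    freq (Finset.univ.powersetCard m) (fun Ω => ¬ IsUniqueCompletion M Ω) ≤ ((n : ℝ) ^ 5)⁻¹ := by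
  have hn' : (2 : ℝ) ≤ n := Nat.ofNat_le_cast.2 hn
  have hα' : (Fintype.card α : ℝ) ≤ n := Nat.cast_le.2 hα
  have hβ' : (Fintype.card β : ℝ) ≤ n := Nat.cast_le.2 hβ
  have hN : (Fintype.card (β × α) : ℝ) ≤ (n : ℝ) ^ 2 := by
    rw [Fintype.card_prod, Nat.cast_mul, sq]
    gcongr
  have hNb2 := S.card_mul_sq_eq (ρ := ρ) (by linarith)
  have hμ := S.half_le_incoherence hρ
  have hμρ := S.quarter_mul_le_sq_incoherence_mul hρ
  have hUV := S.norm_vec_UV_le (ρ := ρ) (by linarith)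
  have hNb := S.card_mul_div_sqrt_le hρ (n := n) (by positivity) hN
  have hκ := S.card_mul_tangentProj_apply_self_le hρ hα' hβ'
  set x := S.incoherence ρ ^ 2 * ρ
  set b := S.incoherence ρ * √ρ / √(Fintype.card (β × α))
  have hx0 : 0 < x := by linarith
  have hb0 : 0 < b := by
    have : 0 < √ρ := Real.sqrt_pos.2 (by linarith)
    have : 0 < S.incoherence ρ := by linarith
    positivity
  have hm' : 1000000 * (x * n * Real.log n ^ 6) ≤ m := by linear_combination hm
  have hxn : x ≤ n := le_of_mul_log_pow_le_sq hn hx0.le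
    (hm'.trans ((Nat.cast_le.2 hmN).trans hN))
  obtain ⟨s, q, hs0, hq0, hs, hq, hqn, hqs⟩ := exists_golfing_parameters hn (K := x * n)
    (by nlinarith)
  refine (S.freq_not_isUniqueCompletion_le_mul_exp (L := 24 * (x * n)) (b := b) (s := s) (q := q)
    (by positivity) hb0 (fun e => (hκ e).trans_eq (by ring)) (hNb.trans ?_) ?_ ?_ hUV hs0 hq0 ?_
    (mod_cast hqs.trans hm') hmN).trans
    (mul_mul_exp_neg_div_le_inv_pow hn (by positivity) hs hqn (by positivity) ?_)
  · linarith [mul_pos hx0 (by linarith : 0 < (n : ℝ))]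
  · rw [hNb2]
    nlinarith
  · rw [hNb2]
    nlinarith
  · rw [hNb2]
    exact quarter_pow_mul_mul_lt_one hn hq0 hq hx0.le hxn hN
  · nlinarith

end MatrixCompletion

/-! ### Tensor completion -/

section TensorCompletion

/-- Multi-indices over two sets of modes that differ only in modes of size one correspond to each
other. -/
def relabelModes {κ : Type} {n : κ → ℕ} (hn : ∀ k, 0 < n k) (p p' : κ → Prop) [DecidablePred p]
    [DecidablePred p'] (h : ∀ k, 2 ≤ n k → (p k ↔ p' k)) :
    (∀ k : {k // p k}, Fin (n k)) ≃ (∀ k : {k // p' k}, Fin (n k)) where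
  toFun a k := if h : p k then a ⟨k, h⟩ else ⟨0, hn k⟩
  invFun a k := if h : p' k then a ⟨k, h⟩ else ⟨0, hn k⟩
  left_inv a := by
    funext ⟨k, hk⟩
    by_cases hk' : p' k
    · simp [hk, hk']
    · have := Fin.subsingleton_iff_le_one.2 (by have := mt (h k); grind : n k ≤ 1)
      exact Subsingleton.elim (α := Fin (n k)) _ _
  right_inv a := by
    funext ⟨k, hk⟩
    by_cases hk' : p k
    · simp [hk, hk']
    · have := Fin.subsingleton_iff_le_one.2 (by have := mt (h k); grind : n k ≤ 1)
      exact Subsingleton.elim (α := Fin (n k)) _ _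

variable {d : ℕ} {n : Fin d → ℕ}

/-- The modes of size at least two among the rows of an unfolding. They determine the unfolding up
to relabelling, and there are at most `∏ k, n k` sets of such modes. -/
def essentialArc (n : Fin d → ℕ) (l : ℕ) (i : Fin d) : Finset (Fin d) :=
  {k | 2 ≤ n k ∧ InArc i l k}

theorem nuclearNorm_unfold_eq_of_essentialArc_eq (hn : ∀ k, 0 < n k) {i j : Fin d} {l : ℕ}
    (h : essentialArc n l i = essentialArc n l j) (X : RTensor n) :
    nuclearNorm (unfold X i l) = nuclearNorm (unfold X j l) := by
  have hij : ∀ k, 2 ≤ n k → (InArc j l k ↔ InArc i l k) := fun k hk => by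
    simpa [essentialArc, hk] using (Finset.ext_iff.1 h k).symm
  rw [← nuclearNorm_submatrix (unfold X i l) (relabelModes hn (InArc j l) (InArc i l) hij)
    (relabelModes hn (fun k => ¬ InArc j l k) (fun k => ¬ InArc i l k)
      fun k hk => not_congr (hij k hk))]
  congr 1
  ext a b
  simp only [Matrix.submatrix_apply, unfold, Matrix.of_apply]
  congr 1
  funext k
  by_cases hk : 2 ≤ n k
  · by_cases hi : InArc i l k
    · simp [hi, (hij k hk).2 hi, relabelModes]
    · have hj : ¬ InArc j l k := fun hj => hi ((hij k hk).1 hj)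
      simp [hi, hj, relabelModes]
  · have : Subsingleton (Fin (n k)) := Fin.subsingleton_iff_le_one.2 (by omega)
    exact Subsingleton.elim _ _

/-- The correspondence between the entries of a tensor and those of its unfolding, the latter
indexed as in `Matrix.vec`. -/
def unfoldEquiv (n : Fin d → ℕ) (i : Fin d) (l : ℕ) :
    (∀ k, Fin (n k)) ≃ ColIdx n i l × RowIdx n i l :=
  (Equiv.piEquivPiSubtypeProd (InArc i l) fun k => Fin (n k)).trans (Equiv.prodComm _ _)

theorem vec_unfold_unfoldEquiv (X : RTensor n) (i : Fin d) (l : ℕ) (j : ∀ k, Fin (n k)) :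
    (unfold X i l).vec (unfoldEquiv n i l j) = X j :=
  congrArg X ((unfoldEquiv n i l).symm_apply_apply j)

theorem unfold_injective (i : Fin d) (l : ℕ) :
    Function.Injective fun X : RTensor n => unfold X i l := fun X Y h => by
  funext j
  rw [← vec_unfold_unfoldEquiv X i l, ← vec_unfold_unfoldEquiv Y i l]
  exact congrArg (fun M => M.vec (unfoldEquiv n i l j)) h

theorem card_rowIdx (i : Fin d) (l : ℕ) :
    Fintype.card (RowIdx n i l) = ∏ k with InArc i l k, n k := by
  simp only [Fintype.card_pi, Fintype.card_fin]
  exact (Finset.prod_subtype _ (by simp) n).symm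

theorem card_colIdx (i : Fin d) (l : ℕ) :
    Fintype.card (ColIdx n i l) = ∏ k with ¬ InArc i l k, n k := by
  simp only [Fintype.card_pi, Fintype.card_fin]
  exact (Finset.prod_subtype _ (by simp) n).symm

theorem prod_le_nbar_sq (n : Fin d → ℕ) (i : Fin d) (l : ℕ) : ∏ k, n k ≤ nbar n i l ^ 2 := by
  rw [← Finset.prod_filter_mul_prod_filter_not Finset.univ (InArc i l), sq]
  exact Nat.mul_le_mul (le_max_left _ _) (le_max_right _ _)

theorem nbar_pos (hn : ∀ k, 0 < n k) (i : Fin d) (l : ℕ) : 0 < nbar n i l :=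
  lt_max_of_lt_left (Finset.prod_pos fun k _ => hn k)

theorem card_filter_inArc {i : Fin d} {l : ℕ} (hl : l ≤ d) :
    ({k | InArc i l k} : Finset (Fin d)).card = l := by
  have : NeZero d := ⟨by have := i.2; omega⟩
  have hmap : ({k | InArc i l k} : Finset (Fin d)).map (Equiv.addRight (-i)).toEmbedding
      = ({k | k.val < l} : Finset (Fin d)) := by
    ext k
    simp [InArc, sub_eq_add_neg]
  rw [← Finset.card_map (Equiv.addRight (-i)).toEmbedding, hmap, Fin.card_filter_val_lt,
    min_eq_right hl]

theorem nbar_const {N : ℕ} (hN : 0 < N) (i : Fin d) {l : ℕ} (hl : l ≤ d) (hdl : d - l ≤ l) :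
    nbar (fun _ : Fin d => N) i l = N ^ l := by
  have hcompl : ({k | ¬ InArc i l k} : Finset (Fin d)).card = d - l := by
    rw [← Finset.compl_filter, Finset.card_compl, card_filter_inArc hl, Fintype.card_fin]
  rw [nbar, Finset.prod_const, Finset.prod_const, card_filter_inArc hl, hcompl]
  exact max_eq_left (Nat.pow_le_pow_right hN hdl)

/-- `T` is the unique minimizer of the nuclear norm of one unfolding, given its entries on `Ω`. -/
def IsUniqueForUnfolding (i : Fin d) (l : ℕ) (T : RTensor n) (Ω : Finset (∀ k, Fin (n k))) : Prop :=
  ∀ X : RTensor n, (∀ j ∈ Ω, X j = T j) → X ≠ T →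
    nuclearNorm (unfold T i l) < nuclearNorm (unfold X i l)

theorem isUniqueForUnfolding_congr (hn : ∀ k, 0 < n k) {i j : Fin d} {l : ℕ}
    (h : essentialArc n l i = essentialArc n l j) (T : RTensor n) :
    IsUniqueForUnfolding i l T = IsUniqueForUnfolding j l T := by
  funext Ω
  simp only [IsUniqueForUnfolding, nuclearNorm_unfold_eq_of_essentialArc_eq hn h]

theorem IsUniqueCompletion.isUniqueForUnfolding {i : Fin d} {l : ℕ} {T : RTensor n}
    {Ω : Finset (∀ k, Fin (n k))}
    (h : IsUniqueCompletion (unfold T i l) (Ω.map (unfoldEquiv n i l).toEmbedding)) :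
    IsUniqueForUnfolding i l T Ω := by
  refine fun X hX hne => h _ (fun e he => ?_) ((unfold_injective i l).ne hne)
  obtain ⟨j, hj, rfl⟩ := Finset.mem_map.1 he
  exact (vec_unfold_unfoldEquiv X i l j).trans
    ((hX j hj).trans (vec_unfold_unfoldEquiv T i l j).symm)

theorem isUniqueSolution_of_forall {w : Fin d → ℝ} {l : ℕ} {T : RTensor n}
    {Ω : Finset (∀ k, Fin (n k))} (hw : ∀ i ∈ shifts d, 0 ≤ w i) (hw' : ∃ i ∈ shifts d, 0 < w i)
    (h : ∀ i ∈ shifts d, IsUniqueForUnfolding i l T Ω) : IsUniqueSolution w l T Ω := by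
  intro X hX hne
  obtain ⟨i, hi, hwi⟩ := hw'
  exact Finset.sum_lt_sum
    (fun i hi => mul_le_mul_of_nonneg_left (h i hi X hX hne).le (hw i hi))
    ⟨i, hi, mul_lt_mul_of_pos_left (h i hi X hX hne) hwi⟩

open scoped BigOperators in
theorem freq_powersetCard_univ_equiv {E F : Type*} [Fintype E] [Fintype F] (e : E ≃ F) (m : ℕ)
    (p : Finset F → Prop) :
    freq (Finset.univ.powersetCard m) p
      = freq (Finset.univ.powersetCard m) fun Ω => p (Ω.map e.toEmbedding) := by
  classical
  rw [freq_eq_expect, freq_eq_expect]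
  exact (Finset.expect_equiv (Equiv.finsetCongr e) (by simp)
    fun Ω _ => rfl).symm

theorem freq_not_isUniqueForUnfolding_le (hn : ∀ k, 0 < n k) {T : RTensor n} {i : Fin d} {l m : ℕ}
    (S : CompactSVD (unfold T i l)) {ρ : ℝ} (hρ : 1 ≤ ρ) (hn2 : 2 ≤ nbar n i l)
    (hmN : m ≤ ∏ k, n k)
    (hm : 1000000 * (S.incoherence ρ ^ 2 * nbar n i l * ρ * Real.log (nbar n i l) ^ 6) ≤ m) :
    freq (Finset.univ.powersetCard m) (fun Ω => ¬ IsUniqueForUnfolding i l T Ω)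
      ≤ ((nbar n i l : ℝ) ^ 5)⁻¹ := by
  have : Nonempty (ColIdx n i l × RowIdx n i l) := ⟨fun k => ⟨0, hn k⟩, fun k => ⟨0, hn k⟩⟩
  have hcard : Fintype.card (ColIdx n i l × RowIdx n i l) = ∏ k, n k := by
    rw [← Fintype.card_congr (unfoldEquiv n i l), Fintype.card_pi]
    simp only [Fintype.card_fin]
  calc freq (Finset.univ.powersetCard m) (fun Ω => ¬ IsUniqueForUnfolding i l T Ω)
      ≤ freq (Finset.univ.powersetCard m) fun Ω =>
          ¬ IsUniqueCompletion (unfold T i l) (Ω.map (unfoldEquiv n i l).toEmbedding) :=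
        freq_mono fun Ω _ => mt IsUniqueCompletion.isUniqueForUnfolding
    _ = freq (Finset.univ.powersetCard m) fun Ω => ¬ IsUniqueCompletion (unfold T i l) Ω :=
        (freq_powersetCard_univ_equiv (unfoldEquiv n i l) m
          fun Ω => ¬ IsUniqueCompletion (unfold T i l) Ω).symm
    _ ≤ ((nbar n i l : ℝ) ^ 5)⁻¹ :=
        S.freq_not_isUniqueCompletion_le hρ hn2 ((card_rowIdx i l).trans_le (le_max_left _ _))
          ((card_colIdx i l).trans_le (le_max_right _ _)) (hcard ▸ hmN) hm

theorem card_image_essentialArc_le (hn : ∀ k, 0 < n k) (l : ℕ) (s : Finset (Fin d)) :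
    (s.image (essentialArc n l)).card ≤ ∏ k, n k := by
  have hsub : s.image (essentialArc n l) ⊆ ({k | 2 ≤ n k} : Finset (Fin d)).powerset := by
    refine Finset.image_subset_iff.2 fun i _ => Finset.mem_powerset.2 fun k hk => ?_
    simp only [essentialArc, Finset.mem_filter, Finset.mem_univ, true_and] at hk ⊢
    exact hk.1
  calc (s.image (essentialArc n l)).card ≤ 2 ^ ({k | 2 ≤ n k} : Finset (Fin d)).card :=
        (Finset.card_le_card hsub).trans_eq (Finset.card_powerset _)
    _ ≤ ∏ k ∈ ({k | 2 ≤ n k} : Finset (Fin d)), n k :=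
        Finset.pow_card_le_prod _ _ _ fun k hk => (Finset.mem_filter.1 hk).2
    _ ≤ ∏ k, n k := Finset.prod_le_prod_of_subset_of_one_le' (Finset.subset_univ _)
        fun k _ _ => hn k

theorem freq_exists_le_card_image_mul {Ω κ γ : Type*} [DecidableEq γ] {A : Finset Ω}
    {p : κ → Ω → Prop} {c : κ → γ} (hp : ∀ i j, c i = c j → p i = p j) {s : Finset κ} {ε : ℝ}
    (hε : ∀ k ∈ s, freq A (p k) ≤ ε) :
    freq A (fun ω => ∃ k ∈ s, p k ω) ≤ (s.image c).card * ε := by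
  calc freq A (fun ω => ∃ k ∈ s, p k ω)
      ≤ freq A fun ω => ∃ a ∈ s.image c, ∃ k, c k = a ∧ p k ω :=
        freq_mono fun ω _ ⟨k, hk, hω⟩ => ⟨c k, Finset.mem_image_of_mem c hk, k, rfl, hω⟩
    _ ≤ ∑ a ∈ s.image c, freq A fun ω => ∃ k, c k = a ∧ p k ω := freq_exists_le _ _
    _ ≤ ∑ _a ∈ s.image c, ε := Finset.sum_le_sum fun a ha => by
        obtain ⟨k, hk, rfl⟩ := Finset.mem_image.1 ha
        exact (freq_mono fun ω _ ⟨j, hj, hω⟩ => hp j k hj ▸ hω).trans (hε k hk)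
    _ = (s.image c).card * ε := by rw [Finset.sum_const, nsmul_eq_mul]

theorem one_sub_le_recoveryProb (hn : ∀ k, 0 < n k) {T : RTensor n} {l m : ℕ} {w : Fin d → ℝ}
    (hw : ∀ i ∈ shifts d, 0 ≤ w i) (hw' : ∃ i ∈ shifts d, 0 < w i) (hmN : m ≤ ∏ k, n k) {F : ℝ}
    (hF : ∀ i ∈ shifts d, (∏ k, n k : ℕ) * freq (Finset.univ.powersetCard m)
      (fun Ω => ¬ IsUniqueForUnfolding i l T Ω) ≤ F) :
    1 - F ≤ recoveryProb w l m T := by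
  have hN : (0 : ℝ) < (∏ k, n k : ℕ) := Nat.cast_pos.2 (Finset.prod_pos fun k _ => hn k)
  have hF0 : 0 ≤ F := by
    obtain ⟨i, hi, -⟩ := hw'
    exact (mul_nonneg hN.le freq_nonneg).trans (hF i hi)
  have hA : ((Finset.univ : Finset (∀ k, Fin (n k))).powersetCard m).Nonempty :=
    Finset.powersetCard_nonempty.2 (by simpa using hmN)
  have hbad : freq (Finset.univ.powersetCard m) (fun Ω => ¬ IsUniqueSolution w l T Ω) ≤ F := by
    calc freq (Finset.univ.powersetCard m) (fun Ω => ¬ IsUniqueSolution w l T Ω)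
        ≤ freq (Finset.univ.powersetCard m) fun Ω =>
            ∃ i ∈ shifts d, ¬ IsUniqueForUnfolding i l T Ω := by
          refine freq_mono fun Ω _ hΩ => ?_
          by_contra! h
          exact hΩ (isUniqueSolution_of_forall hw hw' h)
      _ ≤ ((shifts d).image (essentialArc n l)).card * (F / (∏ k, n k : ℕ)) :=
          freq_exists_le_card_image_mul
            (fun i j h => by rw [isUniqueForUnfolding_congr hn h])
            fun i hi => (le_div_iff₀' hN).2 (hF i hi)
      _ ≤ (∏ k, n k : ℕ) * (F / (∏ k, n k : ℕ)) := by
          gcongr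
          exact card_image_essentialArc_le hn l _
      _ = F := mul_div_cancel₀ _ hN.ne'
  rw [freq_not hA] at hbad
  exact sub_le_comm.1 hbad

theorem one_sub_failureBound_le_recoveryProb [NeZero d] (hn : ∀ k, 0 < n k) {T : RTensor n}
    {l m : ℕ} {w : Fin d → ℝ} (S : ∀ i : Fin d, CompactSVD (unfold T i l)) {ρ : Fin d → ℝ}
    (hρ : ∀ i, 1 ≤ ρ i) (hw : ∀ i ∈ shifts d, 0 ≤ w i) (hw' : ∃ i ∈ shifts d, 0 < w i)
    (hmN : m ≤ ∏ k, n k)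
    (hm : 1000000 * (shifts d).sup' (shifts_nonempty d) (fun i =>
      (S i).incoherence (ρ i) ^ 2 * nbar n i l * ρ i * Real.log (nbar n i l) ^ 6) ≤ m) :
    1 - failureBound n l ≤ recoveryProb w l m T := by
  have hle : ∀ i ∈ shifts d, ((nbar n i l : ℝ) ^ 3)⁻¹ ≤ failureBound n l := fun i hi =>
    Finset.le_sup' (fun i => ((nbar n i l : ℝ) ^ 3)⁻¹) hi
  by_cases hsmall : ∃ i ∈ shifts d, nbar n i l < 2
  · obtain ⟨i, hi, hlt⟩ := hsmall
    have hone : nbar n i l = 1 := by have := nbar_pos hn i l; omega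
    have hfail : 1 ≤ failureBound n l := by simpa [hone] using hle i hi
    have hprob : 0 ≤ recoveryProb w l m T := by unfold recoveryProb; positivity
    linarith
  push Not at hsmall
  refine one_sub_le_recoveryProb hn hw hw' hmN fun i hi => ?_
  have hm' : 1000000 * ((S i).incoherence (ρ i) ^ 2 * nbar n i l * ρ i
      * Real.log (nbar n i l) ^ 6) ≤ m := by
    refine (mul_le_mul_of_nonneg_left ?_ (by norm_num)).trans hm
    exact Finset.le_sup' (fun i => (S i).incoherence (ρ i) ^ 2 * nbar n i l * ρ i
      * Real.log (nbar n i l) ^ 6) hi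
  have hpos := nbar_pos hn i l
  calc (∏ k, n k : ℕ) * freq (Finset.univ.powersetCard m)
        (fun Ω => ¬ IsUniqueForUnfolding i l T Ω)
      ≤ (nbar n i l : ℝ) ^ 2 * ((nbar n i l : ℝ) ^ 5)⁻¹ :=
        mul_le_mul (mod_cast prod_le_nbar_sq n i l)
          (freq_not_isUniqueForUnfolding_le hn (S i) (hρ i) (hsmall i hi) hmN hm') freq_nonneg
          (by positivity)
    _ = ((nbar n i l : ℝ) ^ 3)⁻¹ := by field_simp
    _ ≤ failureBound n l := hle i hi

theorem failureBound_const [NeZero d] {N l : ℕ} (hN : 0 < N) (hl : l ≤ d) (hdl : d - l ≤ l) :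
    failureBound (fun _ : Fin d => N) l = ((N : ℝ) ^ (l * 3))⁻¹ := by
  simp only [failureBound, nbar_const hN _ hl hdl, Finset.sup'_const, Nat.cast_pow, pow_mul]

theorem one_sub_inv_le_recoveryProb_const [NeZero d] {N l m : ℕ} (hN : 0 < N) (hl : l ≤ d)
    (hdl : d - l ≤ l) {T : RTensor fun _ : Fin d => N} {w : Fin d → ℝ}
    (S : ∀ i : Fin d, CompactSVD (unfold T i l)) {ρ K : ℝ} (hρ : 1 ≤ ρ)
    (hw : ∀ i ∈ shifts d, 0 ≤ w i) (hw' : ∃ i ∈ shifts d, 0 < w i)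
    (hμ : ∀ i ∈ shifts d, (S i).incoherence ρ ≤ K * √(Real.log ((N : ℝ) ^ l)))
    (hmN : m ≤ N ^ d)
    (hm : 1000000 * K ^ 2 * ((N : ℝ) ^ l * ρ * Real.log ((N : ℝ) ^ l) ^ 7) ≤ m) :
    1 - ((N : ℝ) ^ (l * 3))⁻¹ ≤ recoveryProb w l m T := by
  have hlog : 0 ≤ Real.log ((N : ℝ) ^ l) := Real.log_nonneg (one_le_pow₀ (mod_cast hN))
  rw [← failureBound_const hN hl hdl]
  refine one_sub_failureBound_le_recoveryProb (fun _ => hN) S (ρ := fun _ => ρ) (fun _ => hρ) hw hw'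
    (by simpa using hmN) (le_trans ?_ hm)
  rw [mul_assoc]
  refine mul_le_mul_of_nonneg_left (Finset.sup'_le _ _ fun i hi => ?_) (by norm_num)
  rw [nbar_const hN i hl hdl, Nat.cast_pow]
  calc (S i).incoherence ρ ^ 2 * (N : ℝ) ^ l * ρ * Real.log ((N : ℝ) ^ l) ^ 6
      ≤ (K * √(Real.log ((N : ℝ) ^ l))) ^ 2 * (N : ℝ) ^ l * ρ * Real.log ((N : ℝ) ^ l) ^ 6 := by
        gcongr
        exacts [(S i).incoherence_nonneg, hμ i hi]
    _ = K ^ 2 * ((N : ℝ) ^ l * ρ * Real.log ((N : ℝ) ^ l) ^ 7) := by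
        rw [mul_pow, Real.sq_sqrt hlog]
        ring

end TensorCompletion

theorem SubOrCritical.pos {d : ℕ} [NeZero d] {n r : Fin d → ℕ} (h : SubOrCritical n r)
    (hr : ∀ k, 0 < r k) (k : Fin d) : 0 < n k :=
  (Nat.mul_pos (hr k) (hr (k + 1))).trans_le (h k)

theorem one_le_cast_mul_cast {a b : ℕ} (ha : 0 < a) (hb : 0 < b) : (1 : ℝ) ≤ a * b :=
  mod_cast Nat.mul_pos ha hb

theorem theorem1_general :
    (∃ C : ℝ, 0 < C ∧
      ∀ (d : ℕ) [NeZero d] (n : Fin d → ℕ) (T : RTensor n) (ρ : Fin d → ℝ) (l : ℕ) (w : Fin d → ℝ)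
        (S : ∀ i : Fin d, CompactSVD (unfold T i l)) (m : ℕ),
        (∀ k, 0 < n k) → (∀ i, 1 ≤ ρ i) →
        (∀ i ∈ shifts d, 0 ≤ w i) → (∃ i ∈ shifts d, 0 < w i) →
        m ≤ ∏ k, n k →
        C * (shifts d).sup' (shifts_nonempty d) (fun i =>
            (S i).incoherence (ρ i) ^ 2 * nbar n i l * ρ i * Real.log (nbar n i l) ^ 6) ≤ m →
        1 - failureBound n l ≤ recoveryProb w l m T) ∧
    (∀ K : ℝ, 0 < K → ∃ C : ℝ, 0 < C ∧
      ∀ (d : ℕ) [NeZero d] (n : ℕ) (T : RTensor fun _ : Fin d => n) (ρ : ℝ) (l : ℕ)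
        (w : Fin d → ℝ) (S : ∀ i : Fin d, CompactSVD (unfold T i l)) (m : ℕ),
        0 < n → 1 ≤ ρ → l ≤ d → d - l ≤ l →
        (∀ i ∈ shifts d, 0 ≤ w i) → (∃ i ∈ shifts d, 0 < w i) →
        (∀ i ∈ shifts d, (S i).incoherence ρ ≤ K * √(Real.log ((n : ℝ) ^ l))) →
        m ≤ n ^ d →
        C * ((n : ℝ) ^ l * ρ * Real.log ((n : ℝ) ^ l) ^ 7) ≤ m →
        1 - ((n : ℝ) ^ (l * 3))⁻¹ ≤ recoveryProb w l m T) :=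
  ⟨⟨1000000, by norm_num, fun _ _ _ _ _ _ _ S _ hn hρ =>
      one_sub_failureBound_le_recoveryProb hn S hρ⟩,
    fun K hK => ⟨1000000 * K ^ 2, by positivity, fun _ _ _ _ _ _ _ S _ hn hρ hl hdl =>
      one_sub_inv_le_recoveryProb_const hn hl hdl S hρ⟩⟩

/-- Exact recovery by weighted nuclear norm minimization from `m` uniformly random entries; the second
part is the (nearly) square unfolding `l = ⌈d/2⌉` of a cubical tensor of rank `[r, …, r]` whose
unfoldings have incoherence of order `√(ln n̄)`. -/
theorem theorem1 :
    (∃ C : ℝ, 0 < C ∧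
      ∀ (d : ℕ) [NeZero d] (n r : Fin d → ℕ) (R : TensorRing n r) (μ : Fin d → ℝ)
        (l : ℕ) (w : Fin d → ℝ) (S : ∀ i : Fin d, CompactSVD (unfold R.eval i l)) (m : ℕ),
        (∀ k, 0 < r k) → SubOrCritical n r → R.StrongIncoherent μ →
        0 < l → l < d →
        (∀ i ∈ shifts d, 0 ≤ w i) → (∃ i ∈ shifts d, 0 < w i) →
        m ≤ ∏ k, n k →
        C * (shifts d).sup' (shifts_nonempty d) (fun i =>
            (S i).incoherence (r i * r (i + Fin.ofNat d l)) ^ 2 * nbar n i l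
              * (r i * r (i + Fin.ofNat d l)) * Real.log (nbar n i l) ^ 6) ≤ m →
        1 - failureBound n l ≤ recoveryProb w l m R.eval) ∧
    (∀ K : ℝ, 0 < K → ∃ C : ℝ, 0 < C ∧
      ∀ (d : ℕ) [NeZero d] (n r : ℕ) (R : TensorRing (fun _ : Fin d => n) (fun _ => r))
        (μ : Fin d → ℝ) (w : Fin d → ℝ)
        (S : ∀ i : Fin d, CompactSVD (unfold R.eval i ((d + 1) / 2))) (m : ℕ),
        2 ≤ d → 0 < r → SubOrCritical (fun _ : Fin d => n) (fun _ => r) → R.StrongIncoherent μ →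
        (∀ i ∈ shifts d, 0 ≤ w i) → (∃ i ∈ shifts d, 0 < w i) →
        (∀ i ∈ shifts d, (S i).incoherence (r * r)
          ≤ K * √(Real.log ((n : ℝ) ^ ((d + 1) / 2)))) →
        m ≤ n ^ d →
        C * ((n : ℝ) ^ ((d + 1) / 2) * (r : ℝ) ^ 2 * Real.log ((n : ℝ) ^ ((d + 1) / 2)) ^ 7) ≤ m →
        1 - ((n : ℝ) ^ ((d + 1) / 2 * 3))⁻¹ ≤ recoveryProb w ((d + 1) / 2) m R.eval) := by
  obtain ⟨⟨C, hC, h⟩, h'⟩ := theorem1_general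
  refine ⟨⟨C, hC, fun d _ n r R _ l w S m hr hn _ _ _ => ?_⟩, fun K hK => ?_⟩
  · exact h d n R.eval _ l w S m (hn.pos hr) fun i => one_le_cast_mul_cast (hr i) (hr _)
  obtain ⟨C, hC, h⟩ := h' K hK
  refine ⟨C, hC, fun d _ n r R _ w S m _ hr hn _ => ?_⟩
  rw [sq]
  exact h d n R.eval _ _ w S m (hn.pos (fun _ => hr) 0) (one_le_cast_mul_cast hr hr) (by omega)
    (by omega)
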